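/- Let $X$ be a Banach lattice of measurable (real- or complex-valued) functions on $\mathbb R^n$ with Lebesgue measure, that is, a Banach space of classes of a.e. equal measurable functions such that $g\in X$, $f$ measurable and $|f|\le |g|$ a.e. imply $f\in X$ and $\|f\|_X\le\|g\|_X$. Suppose that $X$ has the Fatou property: if $f_k\in X$, $\|f_k\|_X\le 1$ and $f_k\to f$ a.e. for a measurable function $f$, then $f\in X$ and $\|f\|_X\le 1$. Let $T: L_2(\mathbb R^n)\to L_2(\mathbb R^n)$ be a linear operator such that (i) $T$ is nondegenerate along some direction $x_0\in\mathbb R^n\setminus\{0\}$: there is a constant $c_0>0$ such that for every ball $B\subset\mathbb R^n$ of radius $r>0$ and every nonnegative $f\in L_2(\mathbb R^n)$ supported on $B$ one has $|Tf(x)|\ge c_0\,\frac1{|B|}\int_B f$ for a.e. $x\in (B+rx_0)\cup(B-rx_0)$; (ii) $T$ is bounded in $X$: there is a constant $C$ such that for every $f\in X\cap L_2(\mathbb R^n)$ one has $Tf\in X$ and $\|Tf\|_X\le C\|f\|_X$. Then there is a constant $c_a$ such that for every collection $\mathcal S=\{Q_l\}$ of cubes or balls in $\mathbb R^n$ (of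 positive side or radius) and every measurable function $f$ with $f\left(\sum_l\chi_{Q_l}\right)^{1/2}\in X$ (where $0\cdot\infty=0$), the function $f$ is integrable over each $Q_l$, the function $\left(\sum_l |f_{Q_l}|^2\chi_{Q_l}\right)^{1/2}$ belongs to $X$, and $$\left\|\Big(\sum_l |f_{Q_l}|^2\chi_{Q_l}\Big)^{1/2}\right\|_X\le c_a\left\|f\Big(\sum_l\chi_{Q_l}\Big)^{1/2}\right\|_X,$$ where $f_Q=\frac1{|Q|}\int_Q f$. The constant $c_a$ does not depend on $f$ or $\mathcal S$. -/

import Mathlib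

open MeasureTheory
open scoped ENNReal NNReal

/-- A lattice of measurable functions: the normed space `X` is identified, through the injective
linear map `J`, with a space of (classes of) measurable functions that contains, together with `g`,
every measurable `f` with `|f| ≤ |g|` a.e., and then `‖f‖ ≤ ‖g‖`. It is a Banach lattice when `X`
is complete. -/
structure IsFunctionLattice {α 𝕜 X : Type*} [MeasurableSpace α] {μ : Measure α} [RCLike 𝕜]
    [NormedAddCommGroup X] [NormedSpace 𝕜 X] (J : X →ₗ[𝕜] (α →ₘ[μ] 𝕜)) : Prop where
  injective : Function.Injective J
  solid : ∀ (g : X) (f : α →ₘ[μ] 𝕜), (∀ᵐ x ∂μ, ‖f x‖ ≤ ‖J g x‖) → ∃ h : X, J h = f ∧ ‖h‖ ≤ ‖g‖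

/-- The Fatou property: the closed unit ball is closed under a.e. convergence of sequences. -/
def HasFatouProperty {α 𝕜 X : Type*} [MeasurableSpace α] {μ : Measure α} [RCLike 𝕜]
    [NormedAddCommGroup X] [NormedSpace 𝕜 X] (J : X →ₗ[𝕜] (α →ₘ[μ] 𝕜)) : Prop :=
  ∀ (u : ℕ → X) (f : α →ₘ[μ] 𝕜), (∀ k, ‖u k‖ ≤ 1) →
    (∀ᵐ x ∂μ, Filter.Tendsto (fun k => J (u k) x) Filter.atTop (nhds (f x))) →
    ∃ h : X, J h = f ∧ ‖h‖ ≤ 1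

/-- The norm in the lattice of a function `φ ≥ 0`, equal to `∞` unless `φ` is a.e. the modulus of an
element of the lattice (in a lattice, all elements with this modulus have the same norm). -/
noncomputable def latticeENorm {α 𝕜 X : Type*} [MeasurableSpace α] {μ : Measure α} [RCLike 𝕜]
    [NormedAddCommGroup X] [NormedSpace 𝕜 X] (J : X →ₗ[𝕜] (α →ₘ[μ] 𝕜)) (φ : α → ℝ≥0∞) : ℝ≥0∞ :=
  ⨅ (g : X) (_ : ∀ᵐ x ∂μ, ‖J g x‖ₑ = φ x), ‖g‖ₑ

/-- `T`, defined on `L²`, is bounded in the lattice: `‖T u‖_X ≤ C ‖u‖_X` for `u ∈ X ∩ L²`. -/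
def IsBoundedInLattice {α 𝕜 X : Type*} [MeasurableSpace α] {μ : Measure α} [RCLike 𝕜]
    [NormedAddCommGroup X] [NormedSpace 𝕜 X] (J : X →ₗ[𝕜] (α →ₘ[μ] 𝕜))
    (T : Lp 𝕜 2 μ →ₗ[𝕜] Lp 𝕜 2 μ) : Prop :=
  ∃ C : ℝ, ∀ (u : Lp 𝕜 2 μ) (g : X), J g = (u : α →ₘ[μ] 𝕜) →
    ∃ h : X, J h = (T u : α →ₘ[μ] 𝕜) ∧ ‖h‖ ≤ C * ‖g‖

/-- `T` is nondegenerate along `x₀`: for some `c > 0`, all balls `B` of radius `r > 0` and all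
`f ≥ 0` in `L²` supported on `B`, `|T f| ≥ c f_B` a.e. on `B + r x₀` and on `B - r x₀`. -/
def IsNondegenerateAlong {n : ℕ} {𝕜 : Type*} [RCLike 𝕜]
    (T : Lp 𝕜 2 (volume : Measure (EuclideanSpace ℝ (Fin n))) →ₗ[𝕜]
      Lp 𝕜 2 (volume : Measure (EuclideanSpace ℝ (Fin n))))
    (x₀ : EuclideanSpace ℝ (Fin n)) : Prop :=
  x₀ ≠ 0 ∧ ∃ c : ℝ, 0 < c ∧ ∀ (z : EuclideanSpace ℝ (Fin n)) (r : ℝ), 0 < r →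
    ∀ f : Lp 𝕜 2 (volume : Measure (EuclideanSpace ℝ (Fin n))),
      (∀ᵐ x, f x = ((‖f x‖ : ℝ) : 𝕜)) → (∀ᵐ x, x ∉ Metric.ball z r → f x = 0) →
      ∀ᵐ x, (x - r • x₀ ∈ Metric.ball z r ∨ x + r • x₀ ∈ Metric.ball z r) →
        c * ⨍ y in Metric.ball z r, ‖f y‖ ≤ ‖T f x‖

/-- A ball of positive radius, open, closed, or with any part of its boundary. -/
def IsBall {n : ℕ} (Q : Set (EuclideanSpace ℝ (Fin n))) : Prop :=
  ∃ (z : EuclideanSpace ℝ (Fin n)) (r : ℝ), 0 < r ∧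
    Metric.ball z r ⊆ Q ∧ Q ⊆ Metric.closedBall z r

/-- A cube of positive side (with sides parallel to the vectors of an orthonormal basis `b`), open,
closed, or with any part of its boundary. -/
def IsCube {n : ℕ} (Q : Set (EuclideanSpace ℝ (Fin n))) : Prop :=
  ∃ (b : OrthonormalBasis (Fin n) ℝ (EuclideanSpace ℝ (Fin n)))
    (z : EuclideanSpace ℝ (Fin n)) (s : ℝ), 0 < s ∧
    {x | ∀ i, |b.repr (x - z) i| < s} ⊆ Q ∧ Q ⊆ {x | ∀ i, |b.repr (x - z) i| ≤ s}

/-- The square averaging operator `(∑_Q |f_Q|² χ_Q)^{1/2}` of a family of sets `Q i`. -/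
noncomputable def squareAveraging {n : ℕ} {𝕜 ι : Type*} [RCLike 𝕜]
    (Q : ι → Set (EuclideanSpace ℝ (Fin n))) (f : EuclideanSpace ℝ (Fin n) → 𝕜)
    (x : EuclideanSpace ℝ (Fin n)) : ℝ≥0∞ :=
  (∑' i, (Q i).indicator (fun _ => ‖⨍ y in Q i, f y‖ₑ ^ 2) x) ^ (1 / 2 : ℝ)

/-- The function `∑_Q χ_Q`. -/
noncomputable def overlap {n : ℕ} {ι : Type*} (Q : ι → Set (EuclideanSpace ℝ (Fin n)))
    (x : EuclideanSpace ℝ (Fin n)) : ℝ≥0∞ :=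
  ∑' i, (Q i).indicator (fun _ => 1) x

/-! Applying $T$ to a nonnegative function carried by a ball $B$ of radius $r$ gives something at
least $c_0$ times its average over $B$ on both neighbours $B\pm rx_0$. So two applications return to
the start: put each $Q_l$ in a comparable ball $B_l$ of radius $r_l$, pass from $f\chi_{Q_l}$ to a
constant on $B_l+r_lx_0$, and from there back to a constant on $B_l\supseteq Q_l$. Up to constants,
$|f_{Q_l}|\chi_{Q_l}$ is thus dominated by two rounds of $T$, and what is needed is boundedness of
$T$ in $X(\ell^2)$ for families $a_iw\chi_{S_i}$.

That is Krivine's consequence of Grothendieck's inequality (`upperENorm_sqrt_sum_apply_le`). With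
$W=w(\sum_i a_i^2\chi_{S_i})^{1/2}$ and $U_k$ the restrictions of $W$ to the atoms of the $S_i$,
each $a_iw\chi_{S_i}$ is $\sum_k v_k(i)U_k$ with $v_k$ in the unit ball of $\ell^2$. The map
$(s_k)\mapsto\sum_k s_kTU_k$ from $\ell^\infty$ to $X$ has norm at most $C\|W\|$, because $|\sum_k
s_kU_k|\le W$ when $|s_k|\le1$. Grothendieck's inequality (`hasSquareBound_of_forall_norm_le_one`)
then admits vectors $v_k$ in place of scalars $s_k$, at the price of a factor 98.

The Fatou property removes the restriction to bounded functions and finite families. Arbitrary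
families reduce to countable ones: where $f\ne0$ the overlap is finite a.e., so only countably many
sets meet $\{f\ne0\}$ in positive measure. Integrability of $f$ on $Q_l$ comes last: an infinite
average would make the square function infinite on a set of positive measure. -/

/-! ### Rademacher sums: orthogonality, fourth moments, truncation -/

section Rademacher

variable {𝕜 Ω : Type*} [RCLike 𝕜]

/-- The Rademacher sum `∑ ε_ω b_ω` over `ω ∈ S`, as a function of the signs `ε`. -/
def rademacherSum (S : Finset Ω) (b : Ω → 𝕜) (ε : Ω → ℤˣ) : 𝕜 :=
  ∑ ω ∈ S, ((ε ω : ℤ) : 𝕜) * b ω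

theorem rademacherSum_sum_mul {κ : Type*} [Fintype κ] (S : Finset Ω) (v : κ → Ω → 𝕜) (c : κ → 𝕜)
    (ε : Ω → ℤˣ) :
    rademacherSum S (fun ω => ∑ k, v k ω * c k) ε = ∑ k, rademacherSum S (v k) ε * c k := by
  simp only [rademacherSum, Finset.mul_sum, Finset.sum_mul]
  rw [Finset.sum_comm]
  simp only [mul_assoc]

/-- The Rademacher sum `∑ ε_ω b_ω`, set to `0` where its modulus exceeds `M`. -/
noncomputable def truncatedRademacherSum [Fintype Ω] (M : ℝ) (b : Ω → 𝕜) (ε : Ω → ℤˣ) : 𝕜 :=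
  if ‖rademacherSum Finset.univ b ε‖ ≤ M then rademacherSum Finset.univ b ε else 0

theorem norm_truncatedRademacherSum_le [Fintype Ω] {M : ℝ} (hM : 0 ≤ M) (b : Ω → 𝕜) (ε : Ω → ℤˣ) :
    ‖truncatedRademacherSum M b ε‖ ≤ M := by
  unfold truncatedRademacherSum
  split_ifs with h
  · exact h
  · simpa using hM

variable [DecidableEq Ω]

theorem rademacherSum_flip (S : Finset Ω) (b : Ω → 𝕜) (ε : Ω → ℤˣ) {i : Ω} (hi : i ∉ S) :
    rademacherSum S b (ε * Pi.mulSingle i (-1)) = rademacherSum S b ε := by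
  refine Finset.sum_congr rfl fun ω hω => ?_
  have : ω ≠ i := fun h => hi (h ▸ hω)
  simp [Pi.mulSingle_eq_of_ne this]

theorem rademacherSum_insert (S : Finset Ω) (b : Ω → 𝕜) (ε : Ω → ℤˣ) {i : Ω} (hi : i ∉ S) :
    rademacherSum (insert i S) b ε = ((ε i : ℤ) : 𝕜) * b i + rademacherSum S b ε :=
  Finset.sum_insert hi

theorem rademacherSum_insert_flip (S : Finset Ω) (b : Ω → 𝕜) (ε : Ω → ℤˣ) {i : Ω} (hi : i ∉ S) :
    rademacherSum (insert i S) b (ε * Pi.mulSingle i (-1)) =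
      -(((ε i : ℤ) : 𝕜) * b i) + rademacherSum S b ε := by
  rw [rademacherSum_insert _ _ _ hi, rademacherSum_flip _ _ _ hi]
  simp

variable [Fintype Ω]

/-- Flipping the sign at `i` permutes the sign vectors. Pairing each vector with its flip cancels
the terms odd in that sign, which drives the inductions on `S` below. -/
theorem two_mul_sum_signs {R : Type*} [CommRing R] (i : Ω) (g : (Ω → ℤˣ) → R) :
    2 * ∑ ε, g ε = ∑ ε, (g ε + g (ε * Pi.mulSingle i (-1))) := by
  rw [Finset.sum_add_distrib, two_mul]
  congr 1
  exact (Equiv.sum_comp (Equiv.mulRight (Pi.mulSingle i (-1) : Ω → ℤˣ)) g).symm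

theorem units_int_cast_mul_self (e : ℤˣ) : ((e : ℤ) : 𝕜) * ((e : ℤ) : 𝕜) = 1 := by
  rcases Int.units_eq_one_or e with rfl | rfl <;> simp

theorem norm_units_int_cast (e : ℤˣ) : ‖((e : ℤ) : 𝕜)‖ = 1 := by
  rcases Int.units_eq_one_or e with rfl | rfl <;> simp

theorem sum_rademacherSum_mul (S : Finset Ω) (b c : Ω → 𝕜) :
    ∑ ε, rademacherSum S b ε * rademacherSum S c ε =
      Fintype.card (Ω → ℤˣ) * ∑ ω ∈ S, b ω * c ω := by
  induction S using Finset.induction_on with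
  | empty => simp [rademacherSum]
  | insert i S hi ih =>
    have h2 : (2 : 𝕜) ≠ 0 := two_ne_zero
    apply mul_left_cancel₀ h2
    rw [two_mul_sum_signs i]
    have : ∀ ε : Ω → ℤˣ, rademacherSum (insert i S) b ε * rademacherSum (insert i S) c ε +
        rademacherSum (insert i S) b (ε * Pi.mulSingle i (-1)) *
          rademacherSum (insert i S) c (ε * Pi.mulSingle i (-1)) =
        2 * (b i * c i) + 2 * (rademacherSum S b ε * rademacherSum S c ε) := by
      intro ε
      simp only [rademacherSum_insert_flip _ _ _ hi, rademacherSum_insert _ _ _ hi]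
      linear_combination 2 * b i * c i * units_int_cast_mul_self (𝕜 := 𝕜) (ε i)
    rw [Finset.sum_congr rfl fun ε _ => this ε, Finset.sum_add_distrib, Finset.sum_const,
      ← Finset.mul_sum, ih, Finset.sum_insert hi, Finset.card_univ, nsmul_eq_mul]
    ring

theorem sum_norm_rademacherSum_sq (S : Finset Ω) (b : Ω → 𝕜) :
    ∑ ε, ‖rademacherSum S b ε‖ ^ 2 = Fintype.card (Ω → ℤˣ) * ∑ ω ∈ S, ‖b ω‖ ^ 2 := by
  have h := sum_rademacherSum_mul S b (fun ω => (starRingEnd 𝕜) (b ω))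
  have hc : ∀ ε, rademacherSum S (fun ω => (starRingEnd 𝕜) (b ω)) ε =
      (starRingEnd 𝕜) (rademacherSum S b ε) := by
    intro ε
    simp [rademacherSum]
  simp only [hc, RCLike.mul_conj] at h
  exact_mod_cast h

theorem norm_add_pow_four_add_norm_sub_pow_four_le (s t : 𝕜) :
    ‖t + s‖ ^ 4 + ‖-t + s‖ ^ 4 ≤ 2 * (‖s‖ ^ 4 + 6 * (‖t‖ ^ 2 * ‖s‖ ^ 2) + ‖t‖ ^ 4) := by
  have h1 := norm_add_sq (𝕜 := 𝕜) s t
  have h2 := norm_sub_sq (𝕜 := 𝕜) s t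
  have h3 := abs_le.1 ((RCLike.abs_re_le_norm (inner 𝕜 s t)).trans (norm_inner_le_norm s t))
  have e1 : ‖t + s‖ = ‖s + t‖ := by rw [add_comm]
  have e2 : ‖-t + s‖ = ‖s - t‖ := by rw [neg_add_eq_sub]
  have e3 : ∀ a : ℝ, a ^ 4 = (a ^ 2) ^ 2 := fun a => by ring
  have h4 : RCLike.re (inner 𝕜 s t) ^ 2 ≤ ‖s‖ ^ 2 * ‖t‖ ^ 2 := by
    rw [← mul_pow]
    exact sq_le_sq' h3.1 h3.2
  rw [e1, e2, e3 ‖s + t‖, e3 ‖s - t‖, h1, h2]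
  nlinarith [h4]

/-- Khintchine's inequality for the fourth moment. The cross term $6\|b_i\|^2A$, where $A$ is the
sum over `S`, is exactly that of $3(A+\|b_i\|^2)^2$. -/
theorem sum_norm_rademacherSum_pow_four_le (S : Finset Ω) (b : Ω → 𝕜) :
    ∑ ε, ‖rademacherSum S b ε‖ ^ 4 ≤
      Fintype.card (Ω → ℤˣ) * (3 * (∑ ω ∈ S, ‖b ω‖ ^ 2) ^ 2) := by
  induction S using Finset.induction_on with
  | empty => simp [rademacherSum]
  | insert i S hi ih =>
    have h2 : (0 : ℝ) < 2 := two_pos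
    refine le_of_mul_le_mul_left ?_ h2
    rw [two_mul_sum_signs i]
    have : ∀ ε : Ω → ℤˣ, ‖rademacherSum (insert i S) b ε‖ ^ 4 +
        ‖rademacherSum (insert i S) b (ε * Pi.mulSingle i (-1))‖ ^ 4 ≤
        2 * (‖rademacherSum S b ε‖ ^ 4 + 6 * (‖b i‖ ^ 2 * ‖rademacherSum S b ε‖ ^ 2)
          + ‖b i‖ ^ 4) := by
      intro ε
      rw [rademacherSum_insert_flip _ _ _ hi, rademacherSum_insert _ _ _ hi]
      refine (norm_add_pow_four_add_norm_sub_pow_four_le _ _).trans_eq ?_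
      rw [norm_mul, norm_units_int_cast, one_mul]
    refine (Finset.sum_le_sum fun ε _ => this ε).trans ?_
    rw [← Finset.mul_sum, Finset.sum_add_distrib, Finset.sum_add_distrib, ← Finset.mul_sum,
      ← Finset.mul_sum, sum_norm_rademacherSum_sq, Finset.sum_insert hi, Finset.sum_const,
      Finset.card_univ, nsmul_eq_mul]
    have hc : (0 : ℝ) ≤ Fintype.card (Ω → ℤˣ) := Nat.cast_nonneg _
    have hA : 0 ≤ ∑ ω ∈ S, ‖b ω‖ ^ 2 := Finset.sum_nonneg fun _ _ => by positivity
    set A := ∑ ω ∈ S, ‖b ω‖ ^ 2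
    nlinarith [mul_nonneg hc (by positivity : 0 ≤ ‖b i‖ ^ 4)]

theorem sum_norm_truncatedRademacherSum_sq_le (M : ℝ) {b : Ω → 𝕜} (hb : ∑ ω, ‖b ω‖ ^ 2 ≤ 1) :
    ∑ ε, ‖truncatedRademacherSum M b ε‖ ^ 2 ≤ Fintype.card (Ω → ℤˣ) := by
  calc ∑ ε, ‖truncatedRademacherSum M b ε‖ ^ 2
      ≤ ∑ ε, ‖rademacherSum Finset.univ b ε‖ ^ 2 := by
        refine Finset.sum_le_sum fun ε _ => ?_
        unfold truncatedRademacherSum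
        split_ifs with h
        · exact le_rfl
        · simp
    _ = Fintype.card (Ω → ℤˣ) * ∑ ω, ‖b ω‖ ^ 2 := sum_norm_rademacherSum_sq _ _
    _ ≤ _ := mul_le_of_le_one_right (Nat.cast_nonneg _) hb

/-- The tail is nonzero only where the sum exceeds $M$ in modulus; there its square is at most its
fourth power divided by $M^2$. -/
theorem sum_norm_rademacherSum_sub_truncated_sq_le {M : ℝ} (hM : 0 < M) {b : Ω → 𝕜}
    (hb : ∑ ω, ‖b ω‖ ^ 2 ≤ 1) :
    ∑ ε, ‖rademacherSum Finset.univ b ε - truncatedRademacherSum M b ε‖ ^ 2 ≤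
      Fintype.card (Ω → ℤˣ) * (3 / M ^ 2) := by
  have h4 := sum_norm_rademacherSum_pow_four_le Finset.univ b
  have hb0 : 0 ≤ ∑ ω, ‖b ω‖ ^ 2 := Finset.sum_nonneg fun _ _ => by positivity
  calc ∑ ε, ‖rademacherSum Finset.univ b ε - truncatedRademacherSum M b ε‖ ^ 2
      ≤ ∑ ε, ‖rademacherSum Finset.univ b ε‖ ^ 4 / M ^ 2 := by
        refine Finset.sum_le_sum fun ε _ => ?_
        unfold truncatedRademacherSum
        split_ifs with h
        · rw [sub_self, norm_zero, zero_pow two_ne_zero]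
          positivity
        · rw [sub_zero, le_div_iff₀ (by positivity)]
          have : M ^ 2 ≤ ‖rademacherSum Finset.univ b ε‖ ^ 2 := by
            have := (not_le.1 h).le
            gcongr
          nlinarith [sq_nonneg ‖rademacherSum Finset.univ b ε‖]
    _ = (∑ ε, ‖rademacherSum Finset.univ b ε‖ ^ 4) / M ^ 2 := by rw [Finset.sum_div]
    _ ≤ (Fintype.card (Ω → ℤˣ) * (3 * (∑ ω, ‖b ω‖ ^ 2) ^ 2)) / M ^ 2 := by gcongr
    _ ≤ (Fintype.card (Ω → ℤˣ) * (3 * 1 ^ 2)) / M ^ 2 := by gcongr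
    _ = _ := by ring

end Rademacher

/-! ### Grothendieck's inequality by truncation and bootstrapping -/

section Grothendieck

/-- A monotone sublinear functional on real functions. -/
structure IsMonotoneSeminorm {α : Type*} (N : (α → ℝ) → ℝ≥0∞) : Prop where
  mono : ∀ φ ψ : α → ℝ, (∀ x, φ x ≤ ψ x) → N φ ≤ N ψ
  add_le : ∀ φ ψ : α → ℝ, N (fun x => φ x + ψ x) ≤ N φ + N ψ
  mul_le : ∀ (c : ℝ) (φ : α → ℝ), 0 ≤ c → N (fun x => c * φ x) ≤ ENNReal.ofReal c * N φ

theorem IsMonotoneSeminorm.sum_le {α ι : Type*} {N : (α → ℝ) → ℝ≥0∞} (hN : IsMonotoneSeminorm N)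
    (s : Finset ι) (φ : ι → α → ℝ) : N (fun x => ∑ i ∈ s, φ i x) ≤ ∑ i ∈ s, N (φ i) := by
  classical
  induction s using Finset.induction_on with
  | empty => simpa using hN.mul_le 0 (fun _ => 0) le_rfl
  | insert i s hi ih =>
    simp only [Finset.sum_insert hi]
    exact (hN.add_le _ _).trans (by gcongr)

/-- Pointwise form of the bootstrapping step, with `c` standing for the values of the functions at
one point. The Euclidean norm of $Y=\sum_k c_kv_k$ is its pairing with a unit vector $a$, and this
pairing is the mean of the product of the two Rademacher sums. Both factors are truncated at 7. The
truncated parts give the first term; the two tails are handled by Cauchy–Schwarz. The level 7 makes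
the tail of $a$ small, since $3/49\le(1/4)^2$. -/
theorem card_mul_sqrt_sum_norm_sq_le {𝕜 Ω κ : Type*} [RCLike 𝕜] [Fintype Ω] [DecidableEq Ω]
    [Fintype κ] (v : κ → Ω → 𝕜) (c : κ → 𝕜) :
    (Fintype.card (Ω → ℤˣ) : ℝ) * √(∑ ω, ‖∑ k, v k ω * c k‖ ^ 2) ≤
      7 * ∑ ε, ‖∑ k, truncatedRademacherSum 7 (v k) ε * c k‖ +
      (√(Fintype.card (Ω → ℤˣ)) / 4) *
        √(∑ ε, ‖∑ k, truncatedRademacherSum 7 (v k) ε * c k‖ ^ 2) +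
      √(Fintype.card (Ω → ℤˣ)) *
        √(∑ ε, ‖∑ k, (rademacherSum Finset.univ (v k) ε -
          truncatedRademacherSum 7 (v k) ε) * c k‖ ^ 2) := by
  set n : ℝ := (Fintype.card (Ω → ℤˣ) : ℝ) with hn
  have hn0 : 0 ≤ n := Nat.cast_nonneg _
  set Y : Ω → 𝕜 := fun ω => ∑ k, v k ω * c k with hY
  set h : ℝ := √(∑ ω, ‖Y ω‖ ^ 2) with hh
  set A : (Ω → ℤˣ) → 𝕜 := fun ε => ∑ k, truncatedRademacherSum 7 (v k) ε * c k with hA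
  set B : (Ω → ℤˣ) → 𝕜 := fun ε => ∑ k, (rademacherSum Finset.univ (v k) ε -
          truncatedRademacherSum 7 (v k) ε) * c k with hB
  rcases (Real.sqrt_nonneg (∑ ω, ‖Y ω‖ ^ 2)).eq_or_lt with h0 | hpos
  · rw [← hh] at h0
    rw [← h0, mul_zero]
    have : 0 ≤ ∑ ε, ‖A ε‖ := Finset.sum_nonneg fun _ _ => norm_nonneg _
    positivity
  rw [← hh] at hpos
  have hsq : ∑ ω, ‖Y ω‖ ^ 2 = h ^ 2 :=
    (Real.sq_sqrt (Finset.sum_nonneg fun _ _ => by positivity)).symm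
  -- The conjugate is needed because the pairing in `sum_rademacherSum_mul` is bilinear.
  set a : Ω → 𝕜 := fun ω => (starRingEnd 𝕜) (Y ω) / (h : 𝕜) with ha
  have ha1 : ∑ ω, ‖a ω‖ ^ 2 ≤ 1 := by
    simp only [ha, norm_div, RCLike.norm_conj, div_pow, RCLike.norm_ofReal, sq_abs]
    rw [← Finset.sum_div, hsq, div_self (by positivity)]
  have hYa : ∑ ω, Y ω * a ω = (h : 𝕜) := by
    have : ∀ ω, Y ω * a ω = ((‖Y ω‖ ^ 2 / h : ℝ) : 𝕜) := by
      intro ω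
      simp only [ha]
      rw [← mul_div_assoc, RCLike.mul_conj]
      push_cast
      rfl
    rw [Finset.sum_congr rfl fun ω _ => this ω, ← RCLike.ofReal_sum, ← Finset.sum_div, hsq]
    congr 1
    field_simp
  have key := sum_rademacherSum_mul Finset.univ Y a
  rw [hYa] at key
  have hRY : ∀ ε, rademacherSum Finset.univ Y ε = A ε + B ε := by
    intro ε
    rw [hY, rademacherSum_sum_mul, hA, hB, ← Finset.sum_add_distrib]
    refine Finset.sum_congr rfl fun k _ => by ring
  have hnh : n * h = ‖∑ ε, rademacherSum Finset.univ Y ε * rademacherSum Finset.univ a ε‖ := by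
    rw [key, norm_mul, RCLike.norm_natCast, RCLike.norm_ofReal, abs_of_pos hpos]
  have hsplit : ∀ ε, ‖rademacherSum Finset.univ Y ε * rademacherSum Finset.univ a ε‖ ≤
      7 * ‖A ε‖ + ‖A ε‖ * ‖rademacherSum Finset.univ a ε - truncatedRademacherSum 7 a ε‖ +
        ‖B ε‖ * ‖rademacherSum Finset.univ a ε‖ := by
    intro ε
    have : rademacherSum Finset.univ Y ε * rademacherSum Finset.univ a ε =
        A ε * truncatedRademacherSum 7 a ε +
        A ε * (rademacherSum Finset.univ a ε - truncatedRademacherSum 7 a ε) +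
        B ε * rademacherSum Finset.univ a ε := by
      rw [hRY]
      ring
    rw [this]
    refine (norm_add₃_le).trans ?_
    rw [norm_mul, norm_mul, norm_mul, mul_comm (7 : ℝ)]
    gcongr
    exact norm_truncatedRademacherSum_le (by norm_num) a ε
  have hCS1 : ∑ ε, ‖A ε‖ * ‖rademacherSum Finset.univ a ε - truncatedRademacherSum 7 a ε‖ ≤
      (√n / 4) * √(∑ ε, ‖A ε‖ ^ 2) := by
    refine (Real.sum_mul_le_sqrt_mul_sqrt _ _ _).trans ?_
    rw [mul_comm]
    gcongr
    rw [Real.sqrt_le_left (by positivity), div_pow, Real.sq_sqrt hn0]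
    refine (sum_norm_rademacherSum_sub_truncated_sq_le (by norm_num) ha1).trans ?_
    rw [← hn]
    linarith
  have hCS2 : ∑ ε, ‖B ε‖ * ‖rademacherSum Finset.univ a ε‖ ≤ √n * √(∑ ε, ‖B ε‖ ^ 2) := by
    refine (Real.sum_mul_le_sqrt_mul_sqrt _ _ _).trans ?_
    rw [mul_comm]
    gcongr
    rw [sum_norm_rademacherSum_sq]
    exact mul_le_of_le_one_right hn0 ha1
  calc n * h ≤ ∑ ε, (7 * ‖A ε‖ +
        ‖A ε‖ * ‖rademacherSum Finset.univ a ε - truncatedRademacherSum 7 a ε‖ +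
        ‖B ε‖ * ‖rademacherSum Finset.univ a ε‖) := by
        rw [hnh]
        exact (norm_sum_le _ _).trans (Finset.sum_le_sum fun ε _ => hsplit ε)
    _ ≤ _ := by
        rw [Finset.sum_add_distrib, Finset.sum_add_distrib, ← Finset.mul_sum]
        gcongr

/-- The functional `N` of `(∑_ω |∑_k v_k(ω) y_k|²)^{1/2}` is at most `K` for all `v_k` in the unit
ball of a finite-dimensional Hilbert space `ℓ²(Ω)`. -/
def HasSquareBound.{u} {α 𝕜 κ : Type*} [RCLike 𝕜] [Fintype κ] (N : (α → ℝ) → ℝ≥0∞)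
    (y : κ → α → 𝕜) (K : ℝ≥0∞) : Prop :=
  ∀ (Ω : Type u) [Fintype Ω] (v : κ → Ω → 𝕜), (∀ k, ∑ ω, ‖v k ω‖ ^ 2 ≤ 1) →
    N (fun x => √(∑ ω, ‖∑ k, v k ω * y k x‖ ^ 2)) ≤ K

section
universe u

variable {α 𝕜 κ : Type*} [RCLike 𝕜] [Fintype κ] {N : (α → ℝ) → ℝ≥0∞} {y : κ → α → 𝕜}
  {K D : ℝ≥0∞}

theorem HasSquareBound.le_ofReal_mul (hK : HasSquareBound.{u} N y K) (hN : IsMonotoneSeminorm N)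
    {Ω : Type u} [Fintype Ω] {t : ℝ} (ht : 0 < t) (v : κ → Ω → 𝕜)
    (hv : ∀ k, ∑ ω, ‖v k ω‖ ^ 2 ≤ t ^ 2) :
    N (fun x => √(∑ ω, ‖∑ k, v k ω * y k x‖ ^ 2)) ≤ ENNReal.ofReal t * K := by
  have h := hK Ω (fun k ω => ((t⁻¹ : ℝ) : 𝕜) * v k ω) (fun k => by
    simp only [norm_mul, RCLike.norm_ofReal, mul_pow, sq_abs]
    rw [← Finset.mul_sum, inv_pow, inv_mul_le_iff₀ (by positivity), mul_one]
    exact hv k)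
  refine le_trans ?_ (mul_le_mul_right h (ENNReal.ofReal t))
  refine le_trans (hN.mono _ _ fun x => ?_) (hN.mul_le t _ ht.le)
  simp only [mul_assoc, ← Finset.mul_sum, norm_mul, RCLike.norm_ofReal, mul_pow, sq_abs]
  rw [Real.sqrt_mul (by positivity), Real.sqrt_sq (by positivity), ← mul_assoc,
    mul_inv_cancel₀ ht.ne', one_mul]

/-- A crude bound from the triangle inequality. It depends on the number of functions, but it is
finite when `D` is, so the iteration can start from it. -/
theorem hasSquareBound_card_mul (hN : IsMonotoneSeminorm N)
    (hD : ∀ s : κ → 𝕜, (∀ k, ‖s k‖ ≤ 1) → N (fun x => ‖∑ k, s k * y k x‖) ≤ D) :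
    HasSquareBound.{u} N y (Fintype.card κ * D) := by
  classical
  intro Ω _ v hv
  have hy : ∀ k, N (fun x => ‖y k x‖) ≤ D := fun k => by
    have := hD (Pi.single k 1) (fun j => by
      rcases eq_or_ne j k with rfl | h
      · simp
      · simp [Pi.single_eq_of_ne h])
    simpa [Pi.single_apply] using this
  calc N (fun x => √(∑ ω, ‖∑ k, v k ω * y k x‖ ^ 2)) ≤ N (fun x => ∑ k, ‖y k x‖) := by
        refine hN.mono _ _ fun x => ?_
        have e1 : √(∑ ω, ‖∑ k, v k ω * y k x‖ ^ 2) =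
            ‖∑ k, y k x • WithLp.toLp 2 (v k)‖ := by
          rw [EuclideanSpace.norm_eq]
          congr 1
          refine Finset.sum_congr rfl fun ω _ => ?_
          simp [mul_comm]
        rw [e1]
        refine (norm_sum_le _ _).trans (Finset.sum_le_sum fun k _ => ?_)
        rw [norm_smul]
        refine mul_le_of_le_one_right (norm_nonneg _) ?_
        rw [EuclideanSpace.norm_eq]
        exact Real.sqrt_le_iff.2 ⟨zero_le_one, by simpa using hv k⟩
    _ ≤ ∑ k, N (fun x => ‖y k x‖) := hN.sum_le _ _
    _ ≤ ∑ _k : κ, D := Finset.sum_le_sum fun k _ => hy k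
    _ = _ := by simp

/-- Truncated Rademacher sums are scalars bounded by 7, so `hD` gives $7D$ for each sign vector,
hence $7\cdot7D$ for the main term. The other two terms are again square functions, now indexed by
the sign vectors, which is why the bound must be assumed for every finite `Ω`. Each of them costs
$K/4$. -/
theorem HasSquareBound.improve (hK : HasSquareBound.{u} N y K) (hN : IsMonotoneSeminorm N)
    (hD : ∀ s : κ → 𝕜, (∀ k, ‖s k‖ ≤ 1) → N (fun x => ‖∑ k, s k * y k x‖) ≤ D) :
    HasSquareBound.{u} N y (49 * D + K / 2) := by
  classical
  intro Ω _ v hv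
  have hcard : 0 < Fintype.card (Ω → ℤˣ) := Fintype.card_pos
  set n : ℝ := (Fintype.card (Ω → ℤˣ) : ℝ) with hn
  have hn0 : 0 < n := by rw [hn]; exact_mod_cast hcard
  have hA1 : ∀ ε : Ω → ℤˣ, N (fun x => ‖∑ k, truncatedRademacherSum 7 (v k) ε * y k x‖) ≤
      7 * D := by
    intro ε
    have h := hD (fun k => ((7⁻¹ : ℝ) : 𝕜) * truncatedRademacherSum 7 (v k) ε) (fun k => by
      rw [norm_mul, RCLike.norm_ofReal, abs_of_pos (by norm_num), inv_mul_le_iff₀ (by norm_num),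
        mul_one]
      exact norm_truncatedRademacherSum_le (by norm_num) _ _)
    have h7 : ENNReal.ofReal 7 = 7 := by norm_num
    rw [← h7]
    refine le_trans ?_ (mul_le_mul_right h (ENNReal.ofReal 7))
    refine le_trans (hN.mono _ _ fun x => ?_) (hN.mul_le 7 _ (by norm_num))
    simp only [mul_assoc, ← Finset.mul_sum, norm_mul, RCLike.norm_ofReal]
    rw [abs_of_pos (by norm_num), ← mul_assoc, mul_inv_cancel₀ (by norm_num), one_mul]
  have hA2 : N (fun x => √(∑ ε : Ω → ℤˣ,
      ‖∑ k, truncatedRademacherSum 7 (v k) ε * y k x‖ ^ 2)) ≤ ENNReal.ofReal √n * K :=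
    hK.le_ofReal_mul hN (by positivity) (fun k ε => truncatedRademacherSum 7 (v k) ε) fun k => by
      rw [Real.sq_sqrt hn0.le]
      exact sum_norm_truncatedRademacherSum_sq_le 7 (hv k)
  have hB : N (fun x => √(∑ ε : Ω → ℤˣ, ‖∑ k, (rademacherSum Finset.univ (v k) ε -
      truncatedRademacherSum 7 (v k) ε) * y k x‖ ^ 2)) ≤ ENNReal.ofReal (√n / 4) * K :=
    hK.le_ofReal_mul hN (by positivity) (fun k ε => rademacherSum Finset.univ (v k) ε -
      truncatedRademacherSum 7 (v k) ε) fun k => by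
      rw [div_pow, Real.sq_sqrt hn0.le]
      refine (sum_norm_rademacherSum_sub_truncated_sq_le (by norm_num) (hv k)).trans ?_
      rw [← hn]
      linarith
  have hcD : ENNReal.ofReal (n⁻¹ * 7) * (∑ _ε : Ω → ℤˣ, 7 * D) = 49 * D := by
    have e : (∑ _ε : Ω → ℤˣ, 7 * D) = ENNReal.ofReal (n * 7) * D := by
      rw [Finset.sum_const, Finset.card_univ, nsmul_eq_mul, ENNReal.ofReal_mul hn0.le, hn,
        ENNReal.ofReal_natCast, mul_assoc]
      norm_num
    rw [e, ← mul_assoc, ← ENNReal.ofReal_mul (by positivity)]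
    congr 1
    have : n⁻¹ * 7 * (n * 7) = 49 := by field_simp; norm_num
    rw [this]
    norm_num
  have hcK : ENNReal.ofReal (n⁻¹ * (√n / 4)) * (ENNReal.ofReal √n * K) +
      ENNReal.ofReal (n⁻¹ * √n) * (ENNReal.ofReal (√n / 4) * K) = K / 2 := by
    have hs : √n * √n = n := Real.mul_self_sqrt hn0.le
    rw [← mul_assoc, ← mul_assoc, ← ENNReal.ofReal_mul (by positivity),
      ← ENNReal.ofReal_mul (by positivity), ← add_mul, ← ENNReal.ofReal_add (by positivity)
      (by positivity)]
    have : n⁻¹ * (√n / 4) * √n + n⁻¹ * √n * (√n / 4) = 2⁻¹ := by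
      have : n⁻¹ * (√n / 4) * √n + n⁻¹ * √n * (√n / 4) = n⁻¹ * (√n * √n) / 2 := by ring
      rw [this, hs]
      field_simp
    rw [this, ENNReal.ofReal_inv_of_pos two_pos, ENNReal.ofReal_ofNat, mul_comm, div_eq_mul_inv]
  calc N (fun x => √(∑ ω, ‖∑ k, v k ω * y k x‖ ^ 2))
      ≤ N (fun x => (n⁻¹ * 7) * ∑ ε, ‖∑ k, truncatedRademacherSum 7 (v k) ε * y k x‖ +
        (n⁻¹ * (√n / 4)) * √(∑ ε, ‖∑ k, truncatedRademacherSum 7 (v k) ε * y k x‖ ^ 2) +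
        (n⁻¹ * √n) * √(∑ ε, ‖∑ k, (rademacherSum Finset.univ (v k) ε -
          truncatedRademacherSum 7 (v k) ε) * y k x‖ ^ 2)) := by
        refine hN.mono _ _ fun x => ?_
        have := card_mul_sqrt_sum_norm_sq_le v (fun k => y k x)
        rw [← hn] at this
        rw [← le_inv_mul_iff₀ hn0] at this
        refine this.trans_eq ?_
        ring
    _ ≤ ENNReal.ofReal (n⁻¹ * 7) * (∑ _ε : Ω → ℤˣ, 7 * D) +
        ENNReal.ofReal (n⁻¹ * (√n / 4)) * (ENNReal.ofReal √n * K) +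
        ENNReal.ofReal (n⁻¹ * √n) * (ENNReal.ofReal (√n / 4) * K) := by
        refine (hN.add_le _ _).trans ?_
        gcongr
        · refine (hN.add_le _ _).trans ?_
          gcongr
          · refine (hN.mul_le _ _ (by positivity)).trans ?_
            gcongr
            refine (hN.sum_le _ _).trans ?_
            gcongr with ε
            exact hA1 ε
          · refine (hN.mul_le _ _ (by positivity)).trans ?_
            gcongr
        · refine (hN.mul_le _ _ (by positivity)).trans ?_
          gcongr
    _ = 49 * D + K / 2 := by
        rw [add_assoc, hcK, hcD]

/-- Grothendieck's inequality, for operators from a finite-dimensional `ℓ^∞` into a lattice. -/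
theorem hasSquareBound_of_forall_norm_le_one (hN : IsMonotoneSeminorm N)
    (hD : ∀ s : κ → 𝕜, (∀ k, ‖s k‖ ≤ 1) → N (fun x => ‖∑ k, s k * y k x‖) ≤ D) :
    HasSquareBound.{u} N y (98 * D) := by
  rcases eq_or_ne D ∞ with rfl | hDtop
  · intro Ω _ v _
    simp
  -- 98 is the fixed point, in units of $D$, of $K\mapsto 49D+K/2$; the excess of the crude bound is
  -- halved each time.
  have hiter : ∀ m : ℕ, HasSquareBound.{u} N y (98 * D + (Fintype.card κ * D) * (2⁻¹) ^ m) := by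
    intro m
    induction m with
    | zero =>
      intro Ω _ v hv
      refine (hasSquareBound_card_mul hN hD Ω v hv).trans ?_
      simp
    | succ m ih =>
      have h := ih.improve hN hD
      have e : 49 * D + (98 * D + (Fintype.card κ * D) * (2⁻¹) ^ m) / 2 =
          98 * D + (Fintype.card κ * D) * (2⁻¹) ^ (m + 1) := by
        have h98 : (98 : ℝ≥0∞) * D = 2 * (49 * D) := by
          rw [← mul_assoc]
          norm_num
        have h2 : 2 * (49 * D) / 2 = 49 * D := by
          rw [mul_comm, ENNReal.mul_div_cancel_right two_ne_zero ENNReal.ofNat_ne_top]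
        rw [ENNReal.add_div, h98, h2, ← add_assoc, ← two_mul, pow_succ, div_eq_mul_inv, mul_assoc]
      rwa [e] at h
  intro Ω _ v hv
  have hlim : Filter.Tendsto (fun m : ℕ => 98 * D + (Fintype.card κ * D) * (2⁻¹ : ℝ≥0∞) ^ m)
      Filter.atTop (nhds (98 * D + (Fintype.card κ * D) * 0)) := by
    refine Filter.Tendsto.const_add _ (ENNReal.Tendsto.const_mul
      (ENNReal.tendsto_pow_atTop_nhds_zero_of_lt_one ?_) (Or.inr ?_))
    · exact ENNReal.inv_lt_one.2 (by norm_num)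
    · exact ENNReal.mul_ne_top (ENNReal.natCast_ne_top _) hDtop
  rw [mul_zero, add_zero] at hlim
  exact ge_of_tendsto' hlim fun m => hiter m Ω v hv

end

end Grothendieck

/-! ### The lattice norm as a monotone sublinear functional, and its Fatou property -/

section UpperENorm

variable {α 𝕜 X : Type*} [MeasurableSpace α] {μ : Measure α} [RCLike 𝕜]
  [NormedAddCommGroup X] [NormedSpace 𝕜 X]

/-- The infimum of the norms of the elements of the lattice whose modulus dominates `φ`. -/
noncomputable def upperENorm (J : X →ₗ[𝕜] (α →ₘ[μ] 𝕜)) (φ : α → ℝ≥0∞) : ℝ≥0∞ :=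
  ⨅ g : {g : X // ∀ᵐ x ∂μ, φ x ≤ ‖J g x‖ₑ}, ‖g.1‖ₑ

variable {J : X →ₗ[𝕜] (α →ₘ[μ] 𝕜)}

theorem upperENorm_le {φ : α → ℝ≥0∞} {g : X} (h : ∀ᵐ x ∂μ, φ x ≤ ‖J g x‖ₑ) :
    upperENorm J φ ≤ ‖g‖ₑ :=
  iInf_le (fun g : {g : X // ∀ᵐ x ∂μ, φ x ≤ ‖J g x‖ₑ} => ‖g.1‖ₑ) ⟨g, h⟩

theorem upperENorm_mono_ae {φ ψ : α → ℝ≥0∞} (h : ∀ᵐ x ∂μ, φ x ≤ ψ x) :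
    upperENorm J φ ≤ upperENorm J ψ :=
  le_iInf fun g => upperENorm_le (by
    filter_upwards [h, g.2] with x h1 h2 using h1.trans h2)

theorem upperENorm_le_latticeENorm (φ : α → ℝ≥0∞) : upperENorm J φ ≤ latticeENorm J φ :=
  le_iInf₂ fun _ hg => upperENorm_le (by filter_upwards [hg] with x hx using hx.ge)

theorem upperENorm_zero : upperENorm J (fun _ => 0) = 0 :=
  le_antisymm ((upperENorm_le (g := 0) (by simp)).trans_eq (by simp)) zero_le

theorem exists_coeFn_eq_norm (hX : IsFunctionLattice J) (g : X) :
    ∃ h : X, (∀ᵐ x ∂μ, J h x = ((‖J g x‖ : ℝ) : 𝕜)) ∧ ‖h‖ ≤ ‖g‖ := by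
  have hm : AEStronglyMeasurable (fun x => ((‖J g x‖ : ℝ) : 𝕜)) μ :=
    RCLike.continuous_ofReal.comp_aestronglyMeasurable (J g).aestronglyMeasurable.norm
  obtain ⟨h, hh, hn⟩ := hX.solid g (AEEqFun.mk _ hm) (by
    filter_upwards [AEEqFun.coeFn_mk _ hm] with x hx
    rw [hx]
    simp)
  refine ⟨h, ?_, hn⟩
  rw [hh]
  exact AEEqFun.coeFn_mk _ hm

theorem upperENorm_add_le (hX : IsFunctionLattice J) (φ ψ : α → ℝ≥0∞) :
    upperENorm J (fun x => φ x + ψ x) ≤ upperENorm J φ + upperENorm J ψ := by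
  refine ENNReal.le_iInf_add_iInf fun g₁ g₂ => ?_
  obtain ⟨h₁, e₁, n₁⟩ := exists_coeFn_eq_norm hX g₁.1
  obtain ⟨h₂, e₂, n₂⟩ := exists_coeFn_eq_norm hX g₂.1
  refine (upperENorm_le (g := h₁ + h₂) ?_).trans ((enorm_add_le _ _).trans
    (add_le_add (enorm_le_iff_norm_le.2 n₁) (enorm_le_iff_norm_le.2 n₂)))
  rw [map_add]
  filter_upwards [e₁, e₂, AEEqFun.coeFn_add (J h₁) (J h₂), g₁.2, g₂.2] with x a₁ a₂ a₃ a₄ a₅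
  rw [a₃, Pi.add_apply, a₁, a₂, ← RCLike.ofReal_add, ← ofReal_norm, RCLike.norm_ofReal,
    abs_of_nonneg (by positivity), ENNReal.ofReal_add (norm_nonneg _) (norm_nonneg _),
    ofReal_norm, ofReal_norm]
  exact add_le_add a₄ a₅

theorem upperENorm_mul_le (c : ℝ) (hc : 0 ≤ c) (φ : α → ℝ≥0∞) :
    upperENorm J (fun x => ENNReal.ofReal c * φ x) ≤ ENNReal.ofReal c * upperENorm J φ := by
  rcases hc.eq_or_lt with rfl | hc
  · simpa using (upperENorm_zero (J := J)).le
  conv_rhs => rw [upperENorm, ENNReal.mul_iInf_of_ne (by simpa using hc) ENNReal.ofReal_ne_top]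
  refine le_iInf fun g => ?_
  have hcn : ‖(c : 𝕜)‖ₑ = ENNReal.ofReal c := by
    rw [← ofReal_norm, RCLike.norm_ofReal, abs_of_pos hc]
  have := upperENorm_le (J := J) (φ := fun x => ENNReal.ofReal c * φ x) (g := (c : 𝕜) • g.1) (by
    rw [map_smul]
    filter_upwards [g.2, AEEqFun.coeFn_smul (c : 𝕜) (J g)] with x hx h2
    rw [h2, Pi.smul_apply, enorm_smul, hcn]
    gcongr)
  rwa [enorm_smul, hcn] at this

theorem isMonotoneSeminorm_upperENorm (hX : IsFunctionLattice J) :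
    IsMonotoneSeminorm fun φ : α → ℝ => upperENorm J fun x => ENNReal.ofReal (φ x) where
  mono φ ψ h := upperENorm_mono_ae (.of_forall fun x => ENNReal.ofReal_le_ofReal (h x))
  add_le φ ψ := (upperENorm_mono_ae (.of_forall fun x => ENNReal.ofReal_add_le)).trans
    (upperENorm_add_le hX _ _)
  mul_le c φ hc := by
    simp only [ENNReal.ofReal_mul hc]
    exact upperENorm_mul_le c hc _

/-- By solidity every majorant of `φ` yields an element representing `φ` of no larger norm. By
injectivity of `J` it is always the same element, so the infimum is attained. -/
theorem exists_of_upperENorm_ne_top (hX : IsFunctionLattice J) {φ : α → ℝ≥0∞}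
    (hφ : AEMeasurable φ μ) (h : upperENorm J φ ≠ ∞) :
    (∀ᵐ x ∂μ, φ x ≠ ∞) ∧ ∃ g : X, (∀ᵐ x ∂μ, J g x = (((φ x).toReal : ℝ) : 𝕜)) ∧
      ‖g‖ₑ ≤ upperENorm J φ := by
  have hne : Nonempty {g : X // ∀ᵐ x ∂μ, φ x ≤ ‖J g x‖ₑ} := by
    by_contra hemp
    rw [not_nonempty_iff] at hemp
    exact h (iInf_of_empty _)
  obtain ⟨g₀, hg₀⟩ := hne
  have hfin : ∀ᵐ x ∂μ, φ x ≠ ∞ := by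
    filter_upwards [hg₀] with x hx using ne_top_of_le_ne_top enorm_ne_top hx
  have hm : AEStronglyMeasurable (fun x => (((φ x).toReal : ℝ) : 𝕜)) μ :=
    RCLike.continuous_ofReal.comp_aestronglyMeasurable hφ.ennreal_toReal.aestronglyMeasurable
  have hex : ∀ g : X, (∀ᵐ x ∂μ, φ x ≤ ‖J g x‖ₑ) →
      ∃ h : X, J h = AEEqFun.mk _ hm ∧ ‖h‖ ≤ ‖g‖ := fun g hg => by
    refine hX.solid g _ ?_
    filter_upwards [AEEqFun.coeFn_mk _ hm, hg] with x hx h2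
    rw [hx, RCLike.norm_ofReal, abs_of_nonneg ENNReal.toReal_nonneg]
    refine ENNReal.toReal_le_of_le_ofReal (norm_nonneg _) ?_
    rwa [ofReal_norm]
  obtain ⟨k, hk, -⟩ := hex g₀ hg₀
  refine ⟨hfin, k, ?_, le_iInf fun g => ?_⟩
  · rw [hk]
    exact AEEqFun.coeFn_mk _ hm
  · obtain ⟨k', hk', hle⟩ := hex g.1 g.2
    rw [hX.injective (hk.trans hk'.symm)]
    exact enorm_le_iff_norm_le.2 hle

theorem latticeENorm_le_upperENorm (hX : IsFunctionLattice J) {φ : α → ℝ≥0∞}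
    (hφ : AEMeasurable φ μ) : latticeENorm J φ ≤ upperENorm J φ := by
  rcases eq_or_ne (upperENorm J φ) ∞ with h | h
  · simp [h]
  obtain ⟨hfin, g, hg, hle⟩ := exists_of_upperENorm_ne_top hX hφ h
  refine (iInf₂_le g ?_).trans hle
  filter_upwards [hfin, hg] with x h1 h2
  rw [h2, ← ofReal_norm, RCLike.norm_ofReal, abs_of_nonneg ENNReal.toReal_nonneg,
    ENNReal.ofReal_toReal h1]

theorem upperENorm_le_of_tendsto_of_ne_top (hX : IsFunctionLattice J) (hF : HasFatouProperty J)
    {φ : ℕ → α → ℝ≥0∞} {ψ : α → ℝ≥0∞} (hφ : ∀ m, AEMeasurable (φ m) μ) (hψ : AEMeasurable ψ μ)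
    (hlim : ∀ᵐ x ∂μ, Filter.Tendsto (fun m => φ m x) Filter.atTop (nhds (ψ x)))
    (hfin : ∀ᵐ x ∂μ, ψ x ≠ ∞) {D : ℝ≥0∞} (hD : ∀ m, upperENorm J (φ m) ≤ D) :
    upperENorm J ψ ≤ D := by
  -- Rescaling to the unit ball needs a positive constant, and `D` may be 0; hence any `d > D` is
  -- used.
  refine le_of_forall_gt_imp_ge_of_dense fun d hd => ?_
  rcases eq_or_ne d ∞ with rfl | hdtop
  · exact le_top
  have hd0 : 0 < d.toReal := ENNReal.toReal_pos (pos_of_gt hd).ne' hdtop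
  have hstep : ∀ m, ∃ g : X, (∀ᵐ x ∂μ, J g x = (((φ m x).toReal : ℝ) : 𝕜)) ∧ ‖g‖ₑ ≤ D :=
    fun m => by
      obtain ⟨-, g, hg, hle⟩ := exists_of_upperENorm_ne_top hX (hφ m)
        (ne_top_of_le_ne_top hd.ne_top (hD m))
      exact ⟨g, hg, hle.trans (hD m)⟩
  choose g hg hgD using hstep
  have hm : AEStronglyMeasurable (fun x => ((d.toReal⁻¹ * (ψ x).toReal : ℝ) : 𝕜)) μ :=
    RCLike.continuous_ofReal.comp_aestronglyMeasurable
      (hψ.ennreal_toReal.const_mul _).aestronglyMeasurable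
  obtain ⟨h, hh, hn⟩ := hF (fun m => ((d.toReal⁻¹ : ℝ) : 𝕜) • g m) (AEEqFun.mk _ hm) (fun m => by
      rw [norm_smul, RCLike.norm_ofReal, abs_of_pos (by positivity), inv_mul_le_iff₀ hd0, mul_one]
      have := (hgD m).trans hd.le
      rw [← ofReal_norm] at this
      exact (ENNReal.ofReal_le_iff_le_toReal hdtop).1 this) (by
      have hall := ae_all_iff.2 hg
      have hsm := ae_all_iff.2 fun m => AEEqFun.coeFn_smul ((d.toReal⁻¹ : ℝ) : 𝕜) (J (g m))
      filter_upwards [hall, hsm, AEEqFun.coeFn_mk _ hm, hlim, hfin] with x h1 h2 h3 h4 h5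
      rw [h3]
      simp only [map_smul, h2, Pi.smul_apply, h1, smul_eq_mul]
      rw [RCLike.ofReal_mul]
      refine Filter.Tendsto.const_mul _ ?_
      exact (RCLike.continuous_ofReal.tendsto _).comp ((ENNReal.tendsto_toReal h5).comp h4))
  refine (upperENorm_le (g := (d.toReal : 𝕜) • h) ?_).trans ?_
  · rw [map_smul, hh]
    filter_upwards [AEEqFun.coeFn_smul (d.toReal : 𝕜) (AEEqFun.mk _ hm), AEEqFun.coeFn_mk _ hm,
      hfin] with x h1 h2 h3
    rw [h1, Pi.smul_apply, h2, smul_eq_mul, ← RCLike.ofReal_mul, ← mul_assoc,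
      mul_inv_cancel₀ hd0.ne', one_mul, ← ofReal_norm, RCLike.norm_ofReal,
      abs_of_nonneg ENNReal.toReal_nonneg, ENNReal.ofReal_toReal h3]
  · rw [enorm_smul, ← ofReal_norm, ← ofReal_norm, ← ENNReal.ofReal_mul (norm_nonneg _)]
    refine ENNReal.ofReal_le_of_le_toReal ?_
    rw [RCLike.norm_ofReal, abs_of_pos hd0]
    exact mul_le_of_le_one_right hd0.le hn

/-- Let $E=\{\psi=\infty\}$. The functions $\min(\varphi_m,t)\chi_E$ tend to the finite function
$t\chi_E$, so $t\|\chi_E\|\le D$ for every $t$. Hence $\chi_E$ has norm zero and $E$ is null. -/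
theorem ae_ne_top_of_upperENorm_bounded (hX : IsFunctionLattice J) (hF : HasFatouProperty J)
    {φ : ℕ → α → ℝ≥0∞} {ψ : α → ℝ≥0∞} (hφ : ∀ m, AEMeasurable (φ m) μ) (hψ : AEMeasurable ψ μ)
    (hlim : ∀ᵐ x ∂μ, Filter.Tendsto (fun m => φ m x) Filter.atTop (nhds (ψ x)))
    {D : ℝ≥0∞} (hDtop : D ≠ ∞) (hD : ∀ m, upperENorm J (φ m) ≤ D) :
    ∀ᵐ x ∂μ, ψ x ≠ ∞ := by
  classical
  set χ : α → ℝ≥0∞ := fun x => if hψ.mk ψ x = ∞ then 1 else 0 with hχ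
  have hχm : Measurable χ :=
    Measurable.ite (hψ.measurable_mk (measurableSet_singleton _)) measurable_const measurable_const
  have hbound : ∀ t : ℕ, upperENorm J (fun x => t * χ x) ≤ D := fun t => by
    refine upperENorm_le_of_tendsto_of_ne_top hX hF (φ := fun m x => min (φ m x) t * χ x)
      (fun m => ((hφ m).min aemeasurable_const).mul hχm.aemeasurable)
      (hχm.const_mul _).aemeasurable ?_ ?_ fun m => ?_
    · filter_upwards [hlim, hψ.ae_eq_mk] with x h1 h2
      by_cases h : hψ.mk ψ x = ∞
      · simp only [hχ, h, if_true, mul_one]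
        have := h1.min (tendsto_const_nhds (x := (t : ℝ≥0∞)))
        rwa [h2, h, min_eq_right le_top] at this
      · simp only [hχ, h, if_false, mul_zero]
        exact tendsto_const_nhds
    · refine .of_forall fun x => ENNReal.mul_ne_top (ENNReal.natCast_ne_top _) ?_
      simp only [hχ]
      split_ifs <;> simp
    · refine le_trans (upperENorm_mono_ae (.of_forall fun x => ?_)) (hD m)
      simp only [hχ]
      split_ifs <;> simp
  have hone : ∀ t : ℕ, t ≠ 0 → upperENorm J χ ≤ D / t := fun t ht => by
    have ht' : (t : ℝ≥0∞) ≠ 0 := by exact_mod_cast ht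
    have h1 := upperENorm_mul_le (J := J) ((t : ℝ)⁻¹) (by positivity) (fun x => t * χ x)
    have e : ENNReal.ofReal ((t : ℝ)⁻¹) = (t : ℝ≥0∞)⁻¹ := by
      rw [ENNReal.ofReal_inv_of_pos (by positivity), ENNReal.ofReal_natCast]
    simp only [e, ← mul_assoc, ENNReal.inv_mul_cancel ht' (ENNReal.natCast_ne_top t),
      one_mul] at h1
    rw [div_eq_mul_inv, mul_comm]
    exact h1.trans (by gcongr; exact hbound t)
  have hzero : upperENorm J χ = 0 := by
    refine le_antisymm ?_ zero_le
    have hl : Filter.Tendsto (fun t : ℕ => D / (t : ℝ≥0∞)) Filter.atTop (nhds 0) := by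
      have := ENNReal.Tendsto.const_mul ENNReal.tendsto_inv_nat_nhds_zero
        (Or.inr hDtop : (0 : ℝ≥0∞) ≠ 0 ∨ D ≠ ∞)
      simpa [div_eq_mul_inv] using this
    refine ge_of_tendsto hl ?_
    filter_upwards [Filter.eventually_ne_atTop 0] with t ht using hone t ht
  obtain ⟨-, g, hg, hle⟩ := exists_of_upperENorm_ne_top hX hχm.aemeasurable (by simp [hzero])
  have hg0 : g = 0 := by
    rw [hzero] at hle
    exact enorm_eq_zero.1 (le_antisymm hle zero_le)
  rw [hg0, map_zero] at hg
  filter_upwards [hg, hψ.ae_eq_mk, AEEqFun.coeFn_zero (α := α) (β := 𝕜) (μ := μ)] with x h1 h2 h3 h4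
  rw [h2] at h4
  rw [h3] at h1
  simp [hχ, h4] at h1

/-- The Fatou property of the lattice norm, for functions that may take the value `∞`. -/
theorem upperENorm_le_of_tendsto (hX : IsFunctionLattice J) (hF : HasFatouProperty J)
    {φ : ℕ → α → ℝ≥0∞} {ψ : α → ℝ≥0∞} (hφ : ∀ m, AEMeasurable (φ m) μ) (hψ : AEMeasurable ψ μ)
    (hlim : ∀ᵐ x ∂μ, Filter.Tendsto (fun m => φ m x) Filter.atTop (nhds (ψ x)))
    {D : ℝ≥0∞} (hD : ∀ m, upperENorm J (φ m) ≤ D) :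
    upperENorm J ψ ≤ D := by
  rcases eq_or_ne D ∞ with rfl | hDtop
  · exact le_top
  exact upperENorm_le_of_tendsto_of_ne_top hX hF hφ hψ hlim
    (ae_ne_top_of_upperENorm_bounded hX hF hφ hψ hlim hDtop hD) hD

end UpperENorm

/-! ### The $\ell^2$-valued extension of an operator bounded in the lattice -/

section VectorValued

variable {α 𝕜 X : Type*} [MeasurableSpace α] {μ : Measure α} [RCLike 𝕜]
  [NormedAddCommGroup X] [NormedSpace 𝕜 X] {J : X →ₗ[𝕜] (α →ₘ[μ] 𝕜)}
  {T : Lp 𝕜 2 μ →ₗ[𝕜] Lp 𝕜 2 μ}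

theorem upperENorm_apply_le (hX : IsFunctionLattice J) {C : ℝ} (hC : 0 < C)
    (hT : ∀ (u : Lp 𝕜 2 μ) (g : X), J g = (u : α →ₘ[μ] 𝕜) →
      ∃ h : X, J h = (T u : α →ₘ[μ] 𝕜) ∧ ‖h‖ ≤ C * ‖g‖)
    (u : Lp 𝕜 2 μ) {W : α → ℝ≥0∞} (hW : ∀ᵐ x ∂μ, ‖u x‖ₑ ≤ W x) :
    upperENorm J (fun x => ‖T u x‖ₑ) ≤ ENNReal.ofReal C * upperENorm J W := by
  conv_rhs => rw [upperENorm, ENNReal.mul_iInf_of_ne (by simpa using hC) ENNReal.ofReal_ne_top]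
  refine le_iInf fun g => ?_
  obtain ⟨g', hg', hn'⟩ := hX.solid g.1 (u : α →ₘ[μ] 𝕜) (by
    filter_upwards [hW, g.2] with x h1 h2 using enorm_le_iff_norm_le.1 (h1.trans h2))
  obtain ⟨h, hh, hn⟩ := hT u g' hg'
  refine (upperENorm_le (g := h) (.of_forall fun x => by rw [hh])).trans ?_
  rw [← ofReal_norm, ← ofReal_norm, ← ENNReal.ofReal_mul hC.le]
  exact ENNReal.ofReal_le_ofReal (hn.trans (by gcongr))

theorem Lp_coeFn_sum_smul {κ : Type*} {p : ℝ≥0∞} (s : Finset κ) (c : κ → 𝕜) (u : κ → Lp 𝕜 p μ) :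
    ∀ᵐ x ∂μ, (∑ k ∈ s, c k • u k : Lp 𝕜 p μ) x = ∑ k ∈ s, c k * u k x := by
  have h : ∀ᵐ x ∂μ, ∀ k ∈ s, (c k • u k) x = c k * u k x :=
    (Finset.eventually_all s).2 fun k _ => Lp.coeFn_smul (c k) (u k)
  filter_upwards [Lp.coeFn_finsetSum s fun k => c k • u k, h] with x h1 h2
  rw [h1, Finset.sum_apply]
  exact Finset.sum_congr rfl h2

/-- The set of points that belong to `S i` exactly for `i ∈ k`. -/
def atomSet {α ι : Type*} (S : ι → Set α) (k : Finset ι) : Set α := {x | ∀ i, x ∈ S i ↔ i ∈ k}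

theorem measurableSet_atomSet {ι : Type*} [Finite ι] {S : ι → Set α}
    (hS : ∀ i, MeasurableSet (S i)) (k : Finset ι) : MeasurableSet (atomSet S k) := by
  classical
  have : atomSet S k = ⋂ i, if i ∈ k then S i else (S i)ᶜ := by
    ext x
    simp only [atomSet, Set.mem_ofPred_eq, Set.mem_iInter]
    refine forall_congr' fun i => ?_
    by_cases h : i ∈ k <;> simp [h]
  rw [this]
  refine MeasurableSet.iInter fun i => ?_
  split_ifs
  · exact hS i
  · exact (hS i).compl

/-- The vector-valued extension of an operator bounded in the lattice, for families of functions
`a_i w χ_{S_i}`. -/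
theorem upperENorm_sqrt_sum_apply_le.{u} {ι : Type u} [Fintype ι] (hX : IsFunctionLattice J)
    {C : ℝ} (hC : 0 < C)
    (hT : ∀ (u : Lp 𝕜 2 μ) (g : X), J g = (u : α →ₘ[μ] 𝕜) →
      ∃ h : X, J h = (T u : α →ₘ[μ] 𝕜) ∧ ‖h‖ ≤ C * ‖g‖)
    {a : ι → ℝ} {w : α → ℝ} (hw : ∀ x, 0 ≤ w x)
    {S : ι → Set α} (hS : ∀ i, MeasurableSet (S i))
    (hwS : ∀ i, MemLp ((S i).indicator fun x => (w x : 𝕜)) 2 μ) (F : ι → Lp 𝕜 2 μ)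
    (hF : ∀ i, ∀ᵐ x ∂μ, F i x = (S i).indicator (fun x => ((a i * w x : ℝ) : 𝕜)) x) :
    upperENorm J (fun x => ENNReal.ofReal √(∑ i, ‖T (F i) x‖ ^ 2)) ≤
      98 * (ENNReal.ofReal C * upperENorm J fun x =>
        ENNReal.ofReal (w x * √(∑ i, (S i).indicator (fun _ => a i ^ 2) x))) := by
  classical
  -- The value of $(\sum_i a_i^2\chi_{S_i})^{1/2}$ on the atom `k`.
  set ρ : Finset ι → ℝ := fun k => √(∑ i ∈ k, a i ^ 2) with hρ
  have hρ0 : ∀ k, 0 ≤ ρ k := fun k => Real.sqrt_nonneg _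
  have hρsq : ∀ k, ρ k ^ 2 = ∑ i ∈ k, a i ^ 2 := fun k =>
    Real.sq_sqrt (Finset.sum_nonneg fun _ _ => sq_nonneg _)
  set U : Finset ι → α → 𝕜 := fun k =>
    (atomSet S k).indicator fun x => ((ρ k * w x : ℝ) : 𝕜) with hU
  have hUmem : ∀ k, MemLp (U k) 2 μ := by
    intro k
    rcases k.eq_empty_or_nonempty with rfl | ⟨i, hi⟩
    · have : U ∅ = fun _ => 0 := by
        funext x
        simp [hU, hρ]
      rw [this]
      exact MemLp.zero'
    · have : U k = (ρ k : 𝕜) • (atomSet S k).indicator ((S i).indicator fun x => (w x : 𝕜)) := by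
        funext x
        simp only [hU, Pi.smul_apply, smul_eq_mul]
        by_cases hx : x ∈ atomSet S k
        · have : x ∈ S i := (hx i).2 hi
          simp [hx, this]
        · simp [hx]
      rw [this]
      exact ((hwS i).indicator (measurableSet_atomSet hS k)).const_smul _
  set u : Finset ι → Lp 𝕜 2 μ := fun k => (hUmem k).toLp (U k) with hu
  have hu_ae : ∀ᵐ x ∂μ, ∀ k, u k x = U k x := ae_all_iff.2 fun k => (hUmem k).coeFn_toLp
  -- Unit vectors, except that if `ρ k = 0` all `a i` with `i ∈ k` vanish and division by zero gives
  -- the right value 0.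
  set v : Finset ι → ι → 𝕜 := fun k i => if i ∈ k then ((a i / ρ k : ℝ) : 𝕜) else 0 with hv
  -- Each point lies in exactly one atom, so only one summand survives.
  have hsum : ∀ (c : Finset ι → 𝕜) (x : α), ∑ k, c k * U k x =
      c (Finset.univ.filter fun i => x ∈ S i) *
        ((ρ (Finset.univ.filter fun i => x ∈ S i) * w x : ℝ) : 𝕜) := by
    intro c x
    rw [Finset.sum_eq_single (Finset.univ.filter fun i => x ∈ S i)]
    · have : x ∈ atomSet S (Finset.univ.filter fun i => x ∈ S i) := fun i => by simp
      simp only [hU, Set.indicator_of_mem this]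
    · intro k _ hk
      have : x ∉ atomSet S k := fun hx => hk (by ext i; simpa using (hx i).symm)
      simp only [hU, Set.indicator_of_notMem this, mul_zero]
    · simp
  have hFu : ∀ i, F i = ∑ k, v k i • u k := by
    intro i
    refine Lp.ext ?_
    filter_upwards [hF i, Lp_coeFn_sum_smul Finset.univ (fun k => v k i) u, hu_ae] with x h1 h2 h3
    rw [h1, h2]
    simp only [h3]
    rw [hsum (fun k => v k i) x]
    by_cases hx : x ∈ S i
    · have hmem : i ∈ Finset.univ.filter fun i => x ∈ S i := by simpa using hx
      simp only [hv, hmem, if_true, Set.indicator_of_mem hx]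
      rw [← RCLike.ofReal_mul]
      congr 1
      rcases (hρ0 (Finset.univ.filter fun i => x ∈ S i)).eq_or_lt with h0 | hpos
      · have hz := hρsq (Finset.univ.filter fun i => x ∈ S i)
        rw [← h0, zero_pow two_ne_zero] at hz
        have := (Finset.sum_eq_zero_iff_of_nonneg fun _ _ => sq_nonneg _).1 hz.symm i hmem
        rw [← h0, pow_eq_zero_iff two_ne_zero |>.1 this]
        simp
      · field_simp
    · simp [hv, hx]
  have hTF : ∀ᵐ x ∂μ, ∀ i, T (F i) x = ∑ k, v k i * T (u k) x := by
    refine ae_all_iff.2 fun i => ?_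
    rw [hFu i, map_sum]
    simp only [map_smul]
    exact Lp_coeFn_sum_smul Finset.univ (fun k => v k i) fun k => T (u k)
  have hv1 : ∀ k, ∑ i, ‖v k i‖ ^ 2 ≤ 1 := by
    intro k
    have : ∑ i, ‖v k i‖ ^ 2 = (∑ i ∈ k, a i ^ 2) / ρ k ^ 2 := by
      rw [Finset.sum_div, ← Finset.sum_subset (Finset.subset_univ k)]
      · refine Finset.sum_congr rfl fun i hi => ?_
        simp only [hv, hi, if_true, RCLike.norm_ofReal, sq_abs, div_pow]
      · intro i _ hi
        simp [hv, hi]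
    rw [this, ← hρsq]
    exact div_self_le_one _
  have hgroth := hasSquareBound_of_forall_norm_le_one.{u} (isMonotoneSeminorm_upperENorm hX)
    (y := fun k x => T (u k) x)
    (D := ENNReal.ofReal C * upperENorm J fun x =>
        ENNReal.ofReal (w x * √(∑ i, (S i).indicator (fun _ => a i ^ 2) x)))
    (fun s hs => by
      have hTs : ∀ᵐ x ∂μ, T (∑ k, s k • u k) x = ∑ k, s k * T (u k) x := by
        rw [map_sum]
        simp only [map_smul]
        exact Lp_coeFn_sum_smul Finset.univ s fun k => T (u k)
      refine (upperENorm_mono_ae ?_).trans (upperENorm_apply_le hX hC hT (∑ k, s k • u k) ?_)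
      · filter_upwards [hTs] with x hx
        rw [hx, ofReal_norm]
      · filter_upwards [Lp_coeFn_sum_smul Finset.univ s u, hu_ae] with x h1 h2
        rw [h1]
        simp only [h2]
        rw [hsum, ← ofReal_norm]
        refine ENNReal.ofReal_le_ofReal ?_
        rw [norm_mul, RCLike.norm_ofReal, abs_of_nonneg (mul_nonneg (hρ0 _) (hw x))]
        refine (mul_le_of_le_one_left (mul_nonneg (hρ0 _) (hw x)) (hs _)).trans_eq ?_
        rw [mul_comm]
        congr 1
        simp only [hρ]
        congr 1
        rw [Finset.sum_filter]
        refine Finset.sum_congr rfl fun i _ => ?_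
        rw [Set.indicator_apply])
  refine le_trans (upperENorm_mono_ae ?_) (hgroth ι v hv1)
  filter_upwards [hTF] with x hx
  simp only [hx]
  exact le_rfl

end VectorValued

/-! ### Moving averages forth and back along the nondegenerate direction -/

section FiniteFamily

variable {n : ℕ} {𝕜 X : Type*} [RCLike 𝕜] [NormedAddCommGroup X] [NormedSpace 𝕜 X]
  {J : X →ₗ[𝕜] (EuclideanSpace ℝ (Fin n) →ₘ[volume] 𝕜)}
  {T : Lp 𝕜 2 (volume : Measure (EuclideanSpace ℝ (Fin n))) →ₗ[𝕜]
      Lp 𝕜 2 (volume : Measure (EuclideanSpace ℝ (Fin n)))}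
  {x₀ : EuclideanSpace ℝ (Fin n)}

/-- Averages over balls, moved by the nondegenerate direction, are controlled in the lattice. -/
theorem upperENorm_sqrt_sum_shift_le {ι : Type*} [Fintype ι] (hX : IsFunctionLattice J)
    {C c : ℝ} (hC : 0 < C) (hc : 0 < c)
    (hTX : ∀ (u : Lp 𝕜 2 (volume : Measure (EuclideanSpace ℝ (Fin n)))) (g : X),
      J g = (u : EuclideanSpace ℝ (Fin n) →ₘ[volume] 𝕜) →
      ∃ h : X, J h = (T u : EuclideanSpace ℝ (Fin n) →ₘ[volume] 𝕜) ∧ ‖h‖ ≤ C * ‖g‖)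
    (hT : ∀ (z : EuclideanSpace ℝ (Fin n)) (r : ℝ), 0 < r →
      ∀ f : Lp 𝕜 2 (volume : Measure (EuclideanSpace ℝ (Fin n))),
      (∀ᵐ x, f x = ((‖f x‖ : ℝ) : 𝕜)) → (∀ᵐ x, x ∉ Metric.ball z r → f x = 0) →
      ∀ᵐ x, (x - r • x₀ ∈ Metric.ball z r ∨ x + r • x₀ ∈ Metric.ball z r) →
        c * ⨍ y in Metric.ball z r, ‖f y‖ ≤ ‖T f x‖)
    {z : ι → EuclideanSpace ℝ (Fin n)} {r : ι → ℝ} (hr : ∀ i, 0 < r i)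
    {S V : ι → Set (EuclideanSpace ℝ (Fin n))} (hS : ∀ i, MeasurableSet (S i))
    (hSB : ∀ i, S i ⊆ Metric.ball (z i) (r i))
    (hV : ∀ i, ∀ x ∈ V i, x - r i • x₀ ∈ Metric.ball (z i) (r i) ∨
      x + r i • x₀ ∈ Metric.ball (z i) (r i))
    {a b : ι → ℝ} (ha : ∀ i, 0 ≤ a i) (hb : ∀ i, 0 ≤ b i)
    {w : EuclideanSpace ℝ (Fin n) → ℝ} (hw : ∀ x, 0 ≤ w x) (hwm : Measurable w)
    {M : ℝ} (hwM : ∀ x, w x ≤ M)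
    (hab : ∀ i, b i ≤ ⨍ y in Metric.ball (z i) (r i), (S i).indicator (fun x => a i * w x) y) :
    upperENorm J (fun x => ENNReal.ofReal √(∑ i, (V i).indicator (fun _ => b i ^ 2) x)) ≤
      ENNReal.ofReal (98 * C / c) * upperENorm J (fun x =>
        ENNReal.ofReal (w x * √(∑ i, (S i).indicator (fun _ => a i ^ 2) x))) := by
  have hmem : ∀ (d : ℝ) i, MemLp ((S i).indicator fun x => ((d * w x : ℝ) : 𝕜)) 2 volume := by
    intro d i
    have hfin : volume (S i) ≠ ∞ :=
      ((measure_mono (hSB i)).trans_lt measure_ball_lt_top).ne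
    rw [memLp_indicator_iff_restrict (hS i)]
    have : IsFiniteMeasure (volume.restrict (S i)) := ⟨by simpa using hfin.lt_top⟩
    refine MemLp.of_bound (C := |d| * M) ?_ (.of_forall fun x => ?_)
    · exact RCLike.continuous_ofReal.comp_aestronglyMeasurable
        (hwm.const_mul _).aestronglyMeasurable
    · rw [RCLike.norm_ofReal, abs_mul, abs_of_nonneg (hw x)]
      gcongr
      exact hwM x
  set F : ι → Lp 𝕜 2 (volume : Measure (EuclideanSpace ℝ (Fin n))) :=
    fun i => (hmem (a i) i).toLp _ with hFdef
  have hF : ∀ i, ∀ᵐ x, F i x = (S i).indicator (fun x => ((a i * w x : ℝ) : 𝕜)) x :=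
    fun i => (hmem (a i) i).coeFn_toLp
  have hnorm : ∀ i, ∀ᵐ x, ‖F i x‖ = (S i).indicator (fun x => a i * w x) x := fun i => by
    filter_upwards [hF i] with x hx
    rw [hx]
    by_cases h : x ∈ S i
    · simp only [Set.indicator_of_mem h, RCLike.norm_ofReal]
      exact abs_of_nonneg (mul_nonneg (ha i) (hw x))
    · simp [h]
  have hlow : ∀ᵐ x, ∀ i, x ∈ V i → c * b i ≤ ‖T (F i) x‖ := by
    refine ae_all_iff.2 fun i => ?_
    have h1 := hT (z i) (r i) (hr i) (F i) (by
      filter_upwards [hF i, hnorm i] with x hx h2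
      rw [h2, hx]
      by_cases h : x ∈ S i <;> simp [h]) (by
      filter_upwards [hF i] with x hx hxB
      rw [hx, Set.indicator_of_notMem fun h => hxB (hSB i h)])
    filter_upwards [h1] with x hx hxV
    refine le_trans ?_ (hx (hV i x hxV))
    have : ⨍ y in Metric.ball (z i) (r i), ‖F i y‖ =
        ⨍ y in Metric.ball (z i) (r i), (S i).indicator (fun x => a i * w x) y :=
      average_congr (ae_restrict_of_ae (hnorm i))
    rw [this]
    exact mul_le_mul_of_nonneg_left (hab i) hc.le
  have hvv := upperENorm_sqrt_sum_apply_le (T := T) hX hC hTX (a := a) hw hS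
    (fun i => by simpa using hmem 1 i) F hF
  have hc' : (0 : ℝ) ≤ c⁻¹ := by positivity
  calc upperENorm J (fun x => ENNReal.ofReal √(∑ i, (V i).indicator (fun _ => b i ^ 2) x))
      ≤ upperENorm J (fun x => ENNReal.ofReal c⁻¹ *
          ENNReal.ofReal √(∑ i, ‖T (F i) x‖ ^ 2)) := by
        refine upperENorm_mono_ae ?_
        filter_upwards [hlow] with x hx
        rw [← ENNReal.ofReal_mul hc']
        refine ENNReal.ofReal_le_ofReal ?_
        rw [← div_eq_inv_mul, le_div_iff₀ hc, mul_comm]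
        refine Real.le_sqrt_of_sq_le ?_
        rw [mul_pow, Real.sq_sqrt (Finset.sum_nonneg fun i _ =>
          Set.indicator_nonneg (fun _ _ => sq_nonneg _) x), Finset.mul_sum]
        refine Finset.sum_le_sum fun i _ => ?_
        by_cases h : x ∈ V i
        · rw [Set.indicator_of_mem h, ← mul_pow]
          exact pow_le_pow_left₀ (mul_nonneg hc.le (hb i)) (hx i h) 2
        · rw [Set.indicator_of_notMem h, mul_zero]
          positivity
    _ ≤ _ := by
        refine (upperENorm_mul_le _ hc' _).trans ?_
        refine (mul_le_mul_right hvv _).trans_eq ?_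
        have e : ENNReal.ofReal (98 * C / c) = ENNReal.ofReal c⁻¹ * (98 * ENNReal.ofReal C) := by
          rw [div_eq_inv_mul, ENNReal.ofReal_mul hc', ENNReal.ofReal_mul (by norm_num)]
          norm_num
        rw [e]
        ring

/-- The square averaging estimate for finite families and bounded functions. -/
theorem upperENorm_sqrt_sum_average_le {ι : Type*} [Fintype ι] (hX : IsFunctionLattice J)
    {C c : ℝ} (hC : 0 < C) (hc : 0 < c)
    (hTX : ∀ (u : Lp 𝕜 2 (volume : Measure (EuclideanSpace ℝ (Fin n)))) (g : X),
      J g = (u : EuclideanSpace ℝ (Fin n) →ₘ[volume] 𝕜) →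
      ∃ h : X, J h = (T u : EuclideanSpace ℝ (Fin n) →ₘ[volume] 𝕜) ∧ ‖h‖ ≤ C * ‖g‖)
    (hT : ∀ (z : EuclideanSpace ℝ (Fin n)) (r : ℝ), 0 < r →
      ∀ f : Lp 𝕜 2 (volume : Measure (EuclideanSpace ℝ (Fin n))),
      (∀ᵐ x, f x = ((‖f x‖ : ℝ) : 𝕜)) → (∀ᵐ x, x ∉ Metric.ball z r → f x = 0) →
      ∀ᵐ x, (x - r • x₀ ∈ Metric.ball z r ∨ x + r • x₀ ∈ Metric.ball z r) →
        c * ⨍ y in Metric.ball z r, ‖f y‖ ≤ ‖T f x‖)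
    {z : ι → EuclideanSpace ℝ (Fin n)} {s : ι → ℝ} (hs : ∀ i, 0 < s i) {R : ℝ} (hR : 0 < R)
    {Q : ι → Set (EuclideanSpace ℝ (Fin n))} (hQ : ∀ i, MeasurableSet (Q i))
    (hBQ : ∀ i, Metric.ball (z i) (s i) ⊆ Q i)
    (hQB : ∀ i, Q i ⊆ Metric.ball (z i) (R * s i))
    {w : EuclideanSpace ℝ (Fin n) → ℝ} (hw : ∀ x, 0 ≤ w x) (hwm : Measurable w)
    {M : ℝ} (hwM : ∀ x, w x ≤ M) :
    upperENorm J (fun x =>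
        ENNReal.ofReal √(∑ i, (Q i).indicator (fun _ => (⨍ y in Q i, w y) ^ 2) x)) ≤
      ENNReal.ofReal (R ^ n * (98 * C / c) ^ 2) * upperENorm J (fun x =>
        ENNReal.ofReal (w x * √(∑ i, (Q i).indicator (fun _ => 1) x))) := by
  have hr : ∀ i, 0 < R * s i := fun i => mul_pos hR (hs i)
  have hRn : 0 < R ^ n := by positivity
  have havg : ∀ i, 0 ≤ ⨍ y in Q i, w y := fun i => by
    rw [setAverage_eq]
    exact smul_nonneg (by positivity) (integral_nonneg hw)
  have hfin : ∀ i, volume (Q i) ≠ ∞ := fun i =>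
    ((measure_mono (hQB i)).trans_lt measure_ball_lt_top).ne
  have hvol : ∀ i, volume.real (Metric.ball (z i) (R * s i)) ≤ R ^ n * volume.real (Q i) :=
    fun i => by
      have h1 : volume.real (Metric.ball (z i) (R * s i)) =
          R ^ n * volume.real (Metric.ball (z i) (s i)) := by
        rw [Measure.real, Measure.addHaar_ball_mul_of_pos _ _ hR, ENNReal.toReal_mul,
          ENNReal.toReal_ofReal (by positivity), finrank_euclideanSpace_fin, Measure.real,
          Measure.addHaar_ball_center volume (z i)]
      rw [h1]
      gcongr
      · exact hfin i
      · exact hBQ i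
  -- The enclosing ball has at most $R^n$ times the volume of $Q_i$, so `b i` is a lower bound for
  -- the average of $w\chi_{Q_i}$ over that ball.
  set b : ι → ℝ := fun i => (R ^ n)⁻¹ * ⨍ y in Q i, w y with hb
  have hb0 : ∀ i, 0 ≤ b i := fun i => mul_nonneg (by positivity) (havg i)
  -- Forth: from `w` on $Q_i$ to the constants `b i` on the shifted balls.
  have step₁ := upperENorm_sqrt_sum_shift_le hX hC hc hTX hT (z := z) hr hQ hQB
    (V := fun i => Metric.ball (z i + (R * s i) • x₀) (R * s i))
    (fun i x hx => Or.inl (by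
      rw [Metric.mem_ball, dist_eq_norm] at hx ⊢
      convert hx using 2
      abel)) (a := fun _ => 1) (b := b) (fun _ => zero_le_one) hb0 hw hwm hwM (fun i => by
      rw [setAverage_eq, setIntegral_indicator (hQ i), Set.inter_eq_right.2 (hQB i), hb]
      simp only [one_mul, smul_eq_mul]
      rw [setAverage_eq, smul_eq_mul, ← mul_assoc, ← mul_inv]
      refine mul_le_mul_of_nonneg_right ?_ (integral_nonneg hw)
      refine inv_anti₀ ?_ (hvol i)
      exact ENNReal.toReal_pos (Metric.measure_ball_pos volume (z i) (hr i)).ne'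
        measure_ball_lt_top.ne)
  -- Back: from the constants `b i` on the shifted balls to the same constants on $Q_i$, using the
  -- opposite shift.
  have step₂ := upperENorm_sqrt_sum_shift_le hX hC hc hTX hT
    (z := fun i => z i + (R * s i) • x₀) hr
    (S := fun i => Metric.ball (z i + (R * s i) • x₀) (R * s i))
    (fun i => Metric.isOpen_ball.measurableSet) (fun i => subset_rfl) (V := Q)
    (fun i x hx => Or.inr (by
      have := hQB i hx
      rw [Metric.mem_ball, dist_eq_norm] at this ⊢
      convert this using 2
      abel)) (a := b) (b := b) hb0 hb0 (w := fun _ => 1) (fun _ => zero_le_one)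
    measurable_const (M := 1) (fun _ => le_rfl) (fun i => by
      rw [setAverage_eq, setIntegral_indicator Metric.isOpen_ball.measurableSet, Set.inter_self,
        ← setAverage_eq, setAverage_const
          (Metric.measure_ball_pos volume _ (hr i)).ne' measure_ball_lt_top.ne, mul_one])
  simp only [one_mul, one_pow] at step₁ step₂
  calc upperENorm J (fun x =>
        ENNReal.ofReal √(∑ i, (Q i).indicator (fun _ => (⨍ y in Q i, w y) ^ 2) x))
      = upperENorm J (fun x => ENNReal.ofReal (R ^ n) *
        ENNReal.ofReal √(∑ i, (Q i).indicator (fun _ => b i ^ 2) x)) := by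
        congr 1
        funext x
        rw [← ENNReal.ofReal_mul hRn.le]
        congr 1
        rw [← Real.sqrt_sq hRn.le, ← Real.sqrt_mul (by positivity), Finset.mul_sum]
        congr 1
        refine Finset.sum_congr rfl fun i _ => ?_
        by_cases h : x ∈ Q i
        · simp only [Set.indicator_of_mem h, hb]
          field_simp
        · simp [h]
    _ ≤ _ := by
        refine (upperENorm_mul_le _ hRn.le _).trans ?_
        refine (mul_le_mul_right (step₂.trans (mul_le_mul_right step₁ _)) _).trans_eq ?_
        rw [← mul_assoc, ← mul_assoc, ← ENNReal.ofReal_mul (by positivity),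
          ← ENNReal.ofReal_mul (by positivity)]
        congr 2
        ring

end FiniteFamily

/-! ### Cubes and balls up to null sets -/

section Geometry

variable {n : ℕ}

/-- The frontier of a convex set is null, so it does not matter which part of the boundary `Q`
contains. -/
theorem ae_eq_of_subset_closure_of_convex {U Q : Set (EuclideanSpace ℝ (Fin n))} (hU : IsOpen U)
    (hconv : Convex ℝ U) (hUQ : U ⊆ Q) (hQU : Q ⊆ closure U) : U =ᵐ[volume] Q := by
  refine Filter.EventuallyLE.antisymm (LE.le.eventuallyLE hUQ) ?_
  refine ae_le_set.2 (measure_mono_null ?_ (hconv.addHaar_frontier volume))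
  rw [hU.frontier_eq]
  exact Set.sdiff_subset_sdiff_left hQU

/-- Cubes and balls are, up to null sets, open sets comparable with balls. -/
theorem exists_isOpen_ae_eq_of_isCube_or_isBall {Q : Set (EuclideanSpace ℝ (Fin n))}
    (h : IsCube Q ∨ IsBall Q) :
    ∃ (U : Set (EuclideanSpace ℝ (Fin n))) (z : EuclideanSpace ℝ (Fin n)) (s : ℝ), 0 < s ∧
      IsOpen U ∧ U ⊆ Q ∧ U =ᵐ[volume] Q ∧ Metric.ball z s ⊆ U ∧
      U ⊆ Metric.ball z ((√n + 2) * s) := by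
  rcases h with ⟨b, z, s, hs, h1, h2⟩ | ⟨z, r, hr, h1, h2⟩
  · set U : Set (EuclideanSpace ℝ (Fin n)) := {x | ∀ i, |b.repr (x - z) i| < s} with hUdef
    have hopen : IsOpen U := by
      have : U = ⋂ i, {x | |b.repr (x - z) i| < s} := by
        ext x
        simp [hUdef]
      rw [this]
      refine isOpen_iInter_of_finite fun i => isOpen_lt ?_ continuous_const
      fun_prop
    have hconv : Convex ℝ U := by
      intro x hx y hy p q hp hq hpq i
      have e : p • x + q • y - z = p • (x - z) + q • (y - z) := by
        have : z = (p + q) • z := by rw [hpq, one_smul]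
        nth_rewrite 1 [this]
        module
      rw [e, map_add, map_smul, map_smul]
      simp only [PiLp.add_apply, PiLp.smul_apply, smul_eq_mul]
      refine (abs_add_le _ _).trans_lt ?_
      rw [abs_mul, abs_mul, abs_of_nonneg hp, abs_of_nonneg hq]
      have hx' := hx i
      have hy' := hy i
      rcases hp.eq_or_lt with rfl | hp'
      · have : q = 1 := by linarith
        subst this
        simpa using hy'
      · have e1 : p * |b.repr (x - z) i| < p * s := by gcongr
        have e2 : q * |b.repr (y - z) i| ≤ q * s := by gcongr
        have e3 : p * s + q * s = s := by rw [← add_mul, hpq, one_mul]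
        linarith
    refine ⟨U, z, s, hs, hopen, h1, ae_eq_of_subset_closure_of_convex hopen hconv h1 ?_, ?_, ?_⟩
    · intro x hx
      have hx' := h2 hx
      -- A point of the closed cube is the limit of its contractions towards the centre, which lie
      -- in the open cube.
      have hlim : Filter.Tendsto (fun t : ℝ => z + t • (x - z)) (nhdsWithin 1 (Set.Iio 1))
          (nhds x) := by
        have hcont : Continuous fun t : ℝ => z + t • (x - z) := by fun_prop
        have := (hcont.tendsto 1).mono_left (nhdsWithin_le_nhds (s := Set.Iio 1))
        simpa using this
      refine mem_closure_of_tendsto hlim ?_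
      filter_upwards [Ioo_mem_nhdsLT (zero_lt_one (α := ℝ))] with t ht i
      rw [add_sub_cancel_left, map_smul, PiLp.smul_apply, smul_eq_mul, abs_mul, abs_of_pos ht.1]
      calc t * |b.repr (x - z) i| ≤ t * s := by
            have := hx' i
            have := ht.1.le
            gcongr
        _ < s := mul_lt_of_lt_one_left hs ht.2
    · intro x hx i
      rw [Metric.mem_ball, dist_eq_norm, ← b.repr.norm_map] at hx
      exact (PiLp.norm_apply_le (b.repr (x - z)) i).trans_lt hx
    · intro x hx
      rw [Metric.mem_ball, dist_eq_norm, ← b.repr.norm_map, EuclideanSpace.norm_eq]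
      calc √(∑ i, ‖b.repr (x - z) i‖ ^ 2) ≤ √(∑ _i : Fin n, s ^ 2) := by
            gcongr with i
            exact (hx i).le
        _ = √n * s := by
            rw [Finset.sum_const, Finset.card_univ, Fintype.card_fin, nsmul_eq_mul,
              Real.sqrt_mul (by positivity), Real.sqrt_sq hs.le]
        _ < (√n + 2) * s := by linarith
  · refine ⟨Metric.ball z r, z, r, hr, Metric.isOpen_ball, h1,
      ae_eq_of_subset_closure_of_convex Metric.isOpen_ball (convex_ball z r) h1
        (by rwa [closure_ball z hr.ne']), subset_rfl, Metric.ball_subset_ball ?_⟩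
    have : 0 ≤ √n := Real.sqrt_nonneg _
    nlinarith

end Geometry

/-! ### From finite to countable families, and from arbitrary to countable ones -/

section CountableFamily

variable {n : ℕ} {𝕜 X : Type*} [RCLike 𝕜] [NormedAddCommGroup X] [NormedSpace 𝕜 X]
  {J : X →ₗ[𝕜] (EuclideanSpace ℝ (Fin n) →ₘ[volume] 𝕜)}

theorem ofReal_sqrt_sum_indicator {α ι : Type*} (s : Finset ι) (U : ι → Set α) {t : ι → ℝ}
    (ht : ∀ i, 0 ≤ t i) (x : α) :
    ENNReal.ofReal √(∑ i ∈ s, (U i).indicator (fun _ => t i ^ 2) x) =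
      (∑ i ∈ s, (U i).indicator (fun _ => ENNReal.ofReal (t i) ^ 2) x) ^ (1 / 2 : ℝ) := by
  have hnn : ∀ i ∈ s, 0 ≤ (U i).indicator (fun _ => t i ^ 2) x := fun i _ =>
    Set.indicator_nonneg (fun _ _ => sq_nonneg _) x
  rw [Real.sqrt_eq_rpow, ← ENNReal.ofReal_rpow_of_nonneg (Finset.sum_nonneg hnn) (by norm_num),
    ENNReal.ofReal_sum_of_nonneg hnn]
  congr 1
  refine Finset.sum_congr rfl fun i _ => ?_
  by_cases h : x ∈ U i
  · simp [h, ENNReal.ofReal_pow (ht i)]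
  · simp [h]

theorem measurable_sum_indicator_rpow {α ι : Type*} [MeasurableSpace α] (s : Finset ι)
    {U : ι → Set α} (hU : ∀ i, MeasurableSet (U i)) (a : ι → ℝ≥0∞) :
    Measurable fun x => (∑ i ∈ s, (U i).indicator (fun _ => a i) x) ^ (1 / 2 : ℝ) :=
  (Finset.measurable_fun_sum s fun i _ => measurable_const.indicator (hU i)).pow_const _

/-- Passage from bounded functions and finite families to arbitrary nonnegative measurable functions
and countable families in the square averaging estimate. -/
theorem upperENorm_squareLAverage_le {ι : Type*} [Countable ι] (hX : IsFunctionLattice J)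
    (hF : HasFatouProperty J) {U : ι → Set (EuclideanSpace ℝ (Fin n))} (hU : ∀ i, IsOpen (U i))
    (hpos : ∀ i, volume (U i) ≠ 0) (hfin : ∀ i, volume (U i) ≠ ∞) {K : ℝ≥0∞}
    (hK : ∀ (s : Finset ι) (w : EuclideanSpace ℝ (Fin n) → ℝ) (M : ℝ), (∀ x, 0 ≤ w x) →
      Measurable w → (∀ x, w x ≤ M) →
      upperENorm J (fun x =>
        ENNReal.ofReal √(∑ i ∈ s, (U i).indicator (fun _ => (⨍ y in U i, w y) ^ 2) x)) ≤
      K * upperENorm J (fun x =>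
        ENNReal.ofReal (w x * √(∑ i ∈ s, (U i).indicator (fun _ => 1) x))))
    {φ : EuclideanSpace ℝ (Fin n) → ℝ≥0∞} (hφ : Measurable φ) :
    upperENorm J (fun x =>
        (∑' i, (U i).indicator (fun _ => (⨍⁻ y in U i, φ y ∂volume) ^ 2) x) ^ (1 / 2 : ℝ)) ≤
      K * upperENorm J (fun x => φ x * overlap U x ^ (1 / 2 : ℝ)) := by
  have hUm : ∀ i, MeasurableSet (U i) := fun i => (hU i).measurableSet
  have hfinite : ∀ s : Finset ι, upperENorm J (fun x =>
        (∑ i ∈ s, (U i).indicator (fun _ => (⨍⁻ y in U i, φ y ∂volume) ^ 2) x) ^ (1 / 2 : ℝ)) ≤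
      K * upperENorm J (fun x => φ x * overlap U x ^ (1 / 2 : ℝ)) := by
    intro s
    -- Truncations of `φ` are bounded, so `hK` applies; their averages increase to those of `φ` by
    -- monotone convergence.
    set w : ℕ → EuclideanSpace ℝ (Fin n) → ℝ := fun m x => (min (φ x) m).toReal with hw
    have hwm : ∀ m, Measurable (w m) := fun m => (hφ.min measurable_const).ennreal_toReal
    have hw0 : ∀ m x, 0 ≤ w m x := fun m x => ENNReal.toReal_nonneg
    have hmin : ∀ (m : ℕ) x, min (φ x) m ≠ ∞ := fun m x =>
      ne_top_of_le_ne_top (ENNReal.natCast_ne_top m) (min_le_right _ _)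
    have hwM : ∀ (m : ℕ) x, w m x ≤ m := fun m x =>
      (ENNReal.toReal_mono (ENNReal.natCast_ne_top m) (min_le_right _ _)).trans_eq (by simp)
    have hwofReal : ∀ m x, ENNReal.ofReal (w m x) = min (φ x) m := fun m x =>
      ENNReal.ofReal_toReal (hmin m x)
    have havg0 : ∀ m i, 0 ≤ ⨍ y in U i, w m y := fun m i => by
      rw [setAverage_eq]
      exact smul_nonneg (by positivity) (integral_nonneg (hw0 m))
    have havg : ∀ m i, ENNReal.ofReal (⨍ y in U i, w m y) =
        (∫⁻ y in U i, min (φ y) m) / volume (U i) := fun m i => by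
      rw [ofReal_setAverage _ (.of_forall (hw0 m))]
      · simp only [hwofReal]
      · exact Measure.integrableOn_of_bounded (M := m) (hfin i) (hwm m).aestronglyMeasurable
          (.of_forall fun x => by rw [Real.norm_of_nonneg (hw0 m x)]; exact hwM m x)
    refine upperENorm_le_of_tendsto hX hF (φ := fun (m : ℕ) x =>
      (∑ i ∈ s, (U i).indicator (fun _ => ENNReal.ofReal (⨍ y in U i, w m y) ^ 2) x) ^ (1 / 2 : ℝ))
      (fun m => (measurable_sum_indicator_rpow s hUm _).aemeasurable)
      (measurable_sum_indicator_rpow s hUm _).aemeasurable (.of_forall fun x => ?_) fun m => ?_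
    · refine (ENNReal.continuous_rpow_const.tendsto _).comp (tendsto_finsetSum s fun i _ => ?_)
      by_cases hx : x ∈ U i
      · simp only [Set.indicator_of_mem hx, havg, setLAverage_eq]
        refine ((ENNReal.continuous_pow 2).tendsto _).comp
          (ENNReal.Tendsto.div_const ?_ (Or.inr (hpos i)))
        refine lintegral_tendsto_of_tendsto_of_monotone
          (fun m => (hφ.min measurable_const).aemeasurable) (.of_forall fun y => ?_)
          (.of_forall fun y => ?_)
        · intro p q hpq
          exact min_le_min_left _ (by exact_mod_cast hpq)
        · have := (tendsto_const_nhds (x := φ y)).min ENNReal.tendsto_nat_nhds_top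
          rwa [min_eq_left le_top] at this
      · simp only [Set.indicator_of_notMem hx]
        exact tendsto_const_nhds
    · simp only [← ofReal_sqrt_sum_indicator s U (havg0 m)]
      refine (hK s (w m) m (hw0 m) (hwm m) (hwM m)).trans ?_
      refine mul_le_mul_right (upperENorm_mono_ae (.of_forall fun x => ?_)) K
      have h1 := ofReal_sqrt_sum_indicator s U (t := fun _ => 1) (fun _ => zero_le_one) x
      simp only [one_pow, ENNReal.ofReal_one] at h1
      rw [ENNReal.ofReal_mul (hw0 m x), hwofReal, h1]
      refine mul_le_mul' (min_le_left _ _) (ENNReal.rpow_le_rpow ?_ (by norm_num))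
      exact ENNReal.sum_le_tsum s
  obtain ⟨s, hs⟩ := Filter.exists_seq_tendsto (Filter.atTop : Filter (Finset ι))
  refine upperENorm_le_of_tendsto hX hF (φ := fun m x =>
    (∑ i ∈ s m, (U i).indicator (fun _ => (⨍⁻ y in U i, φ y ∂volume) ^ 2) x) ^ (1 / 2 : ℝ))
    (fun m => (measurable_sum_indicator_rpow (s m) hUm _).aemeasurable)
    ((Measurable.tsum fun i => measurable_const.indicator (hUm i)).pow_const _).aemeasurable
    (.of_forall fun x => ?_) fun m => hfinite (s m)
  exact (ENNReal.continuous_rpow_const.tendsto _).comp (ENNReal.summable.hasSum.comp hs)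

/-- Only countably many sets of a family meet a set where their overlap is finite. -/
theorem countable_setOf_measure_inter_ne_zero {α ι : Type*} [MeasurableSpace α] {μ : Measure α}
    {U : ι → Set α} (hU : ∀ i, MeasurableSet (U i)) {A : ℕ → Set α}
    (hA : ∀ m, MeasurableSet (A m)) (hAfin : ∀ m, μ (A m) ≠ ∞)
    (hle : ∀ m, ∀ᵐ x ∂μ, x ∈ A m → ∑' i, (U i).indicator (fun _ => (1 : ℝ≥0∞)) x ≤ m) :
    {i | μ (U i ∩ ⋃ m, A m) ≠ 0}.Countable := by
  -- Integrating the overlap over $A_m$ bounds this sum by $m\,\mu(A_m)$, and a finite sum has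
  -- countably many nonzero terms.
  have hsum : ∀ m, ∑' i, μ (U i ∩ A m) ≠ ∞ := fun m => by
    refine ne_top_of_le_ne_top (ENNReal.mul_ne_top (ENNReal.natCast_ne_top m) (hAfin m)) ?_
    rw [ENNReal.tsum_eq_iSup_sum]
    refine iSup_le fun s => ?_
    calc ∑ i ∈ s, μ (U i ∩ A m)
        = ∑ i ∈ s, ∫⁻ x in A m, (U i).indicator (fun _ => (1 : ℝ≥0∞)) x ∂μ := by
          refine Finset.sum_congr rfl fun i _ => ?_
          rw [lintegral_indicator (hU i), setLIntegral_const, one_mul,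
            Measure.restrict_apply (hU i)]
      _ = ∫⁻ x in A m, ∑ i ∈ s, (U i).indicator (fun _ => (1 : ℝ≥0∞)) x ∂μ :=
          (lintegral_finsetSum s fun i _ => measurable_const.indicator (hU i)).symm
      _ ≤ ∫⁻ _x in A m, m ∂μ := by
          refine lintegral_mono_ae ((ae_restrict_iff' (hA m)).2 ?_)
          filter_upwards [hle m] with x hx hxA
          exact (ENNReal.sum_le_tsum s).trans (hx hxA)
      _ = m * μ (A m) := setLIntegral_const _ _
  refine (Set.countable_iUnion fun m => Summable.countable_support_ennreal (hsum m)).mono fun i hi => ?_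
  by_contra hcon
  refine hi ?_
  rw [Set.inter_iUnion, measure_iUnion_null_iff]
  intro m
  by_contra h
  exact hcon (Set.mem_iUnion.2 ⟨m, h⟩)

end CountableFamily

theorem countable_setOf_measure_inter_support_ne_zero {n : ℕ} {𝕜 ι : Type*} [RCLike 𝕜]
    {U Q : ι → Set (EuclideanSpace ℝ (Fin n))} (hU : ∀ i, IsOpen (U i)) (hUQ : ∀ i, U i ⊆ Q i)
    {φ : EuclideanSpace ℝ (Fin n) → ℝ≥0∞} (hφ : Measurable φ) (hφtop : ∀ x, φ x ≠ ∞)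
    (G : EuclideanSpace ℝ (Fin n) →ₘ[volume] 𝕜)
    (hG : ∀ᵐ x, ‖G x‖ₑ = φ x * overlap Q x ^ (1 / 2 : ℝ)) :
    {i | volume (U i ∩ {x | φ x ≠ 0}) ≠ 0}.Countable := by
  have hGm : Measurable fun x => ‖G x‖ₑ := G.measurable.enorm
  -- On $A_m$ the second condition says, a.e., that the overlap is at most $m$. It is phrased
  -- through `G` because the overlap of an uncountable family need not be measurable.
  set A : ℕ → Set (EuclideanSpace ℝ (Fin n)) := fun m =>
    {x | φ x ≠ 0} ∩ {x | ‖G x‖ₑ ^ 2 ≤ m * φ x ^ 2} ∩ Metric.ball 0 m with hAdef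
  have hA : ∀ m, MeasurableSet (A m) := fun m =>
    ((hφ (measurableSet_singleton 0).compl).inter
      (measurableSet_le (hGm.pow_const 2) ((hφ.pow_const 2).const_mul _))).inter measurableSet_ball
  have hAfin : ∀ m, volume (A m) ≠ ∞ := fun m =>
    ((measure_mono Set.inter_subset_right).trans_lt measure_ball_lt_top).ne
  have hcover : {x | φ x ≠ 0} ⊆ ⋃ m, A m := by
    intro x hx
    have hx2 : φ x ^ 2 ≠ 0 := pow_ne_zero 2 hx
    have hq : ‖G x‖ₑ ^ 2 / φ x ^ 2 ≠ ∞ :=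
      ENNReal.div_ne_top (ENNReal.pow_ne_top enorm_ne_top) hx2
    obtain ⟨p, hp⟩ := ENNReal.exists_nat_gt hq
    obtain ⟨q, hq'⟩ := exists_nat_gt ‖x‖
    refine Set.mem_iUnion.2 ⟨max p q, ⟨hx, ?_⟩, ?_⟩
    · have h1 : ‖G x‖ₑ ^ 2 / φ x ^ 2 ≤ (max p q : ℕ) :=
        hp.le.trans (by exact_mod_cast le_max_left p q)
      exact (ENNReal.div_le_iff hx2 (ENNReal.pow_ne_top (hφtop x))).1 h1
    · rw [mem_ball_zero_iff]
      exact hq'.trans_le (by exact_mod_cast le_max_right p q)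
  refine Set.Countable.mono ?_ (countable_setOf_measure_inter_ne_zero (U := U) (A := A)
    (fun i => (hU i).measurableSet) hA hAfin fun m => ?_)
  · exact fun i hi h0 => hi (measure_mono_null (Set.inter_subset_inter_right _ hcover) h0)
  · filter_upwards [hG] with x hx hxA
    have h1 : ‖G x‖ₑ ^ 2 ≤ m * φ x ^ 2 := hxA.1.2
    have h2 : (overlap Q x ^ (1 / 2 : ℝ)) ^ 2 = overlap Q x := by
      rw [← ENNReal.rpow_natCast, ← ENNReal.rpow_mul]
      norm_num
    rw [hx, mul_pow, h2, mul_comm] at h1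
    have h3 : overlap Q x ≤ m := (ENNReal.mul_le_mul_iff_left (pow_ne_zero 2 hxA.1.1)
      (ENNReal.pow_ne_top (hφtop x))).1 h1
    refine le_trans (ENNReal.tsum_le_tsum fun i => ?_) h3
    exact Set.indicator_le_indicator_of_subset (hUQ i) (fun _ => zero_le) x

/-! ### The square averaging estimate -/

theorem mainTheorem9 {n : ℕ} {𝕜 : Type*} [RCLike 𝕜]
    {X : Type*} [NormedAddCommGroup X] [NormedSpace 𝕜 X] [CompleteSpace X]
    (J : X →ₗ[𝕜] (EuclideanSpace ℝ (Fin n) →ₘ[volume] 𝕜))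
    (hX : IsFunctionLattice J) (hFatou : HasFatouProperty J)
    (T : Lp 𝕜 2 (volume : Measure (EuclideanSpace ℝ (Fin n))) →ₗ[𝕜]
      Lp 𝕜 2 (volume : Measure (EuclideanSpace ℝ (Fin n))))
    (x₀ : EuclideanSpace ℝ (Fin n)) (hT : IsNondegenerateAlong T x₀)
    (hTX : IsBoundedInLattice J T) :
    ∃ c : ℝ≥0, ∀ {ι : Type*} (Q : ι → Set (EuclideanSpace ℝ (Fin n))),
      (∀ i, IsCube (Q i) ∨ IsBall (Q i)) →
      ∀ f : EuclideanSpace ℝ (Fin n) → 𝕜, AEStronglyMeasurable f volume →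
        latticeENorm J (fun x => ‖f x‖ₑ * overlap Q x ^ (1 / 2 : ℝ)) ≠ ∞ →
        (∀ i, IntegrableOn f (Q i) volume) ∧
        latticeENorm J (squareAveraging Q f) ≤
          c * latticeENorm J (fun x => ‖f x‖ₑ * overlap Q x ^ (1 / 2 : ℝ)) := by
  obtain ⟨-, c, hc, hT⟩ := hT
  obtain ⟨C', hC'⟩ := hTX
  set C : ℝ := max C' 1 with hCdef
  have hC : 0 < C := lt_max_of_lt_right one_pos
  have hTC : ∀ (u : Lp 𝕜 2 (volume : Measure (EuclideanSpace ℝ (Fin n)))) (g : X),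
      J g = (u : EuclideanSpace ℝ (Fin n) →ₘ[volume] 𝕜) →
      ∃ h : X, J h = (T u : EuclideanSpace ℝ (Fin n) →ₘ[volume] 𝕜) ∧ ‖h‖ ≤ C * ‖g‖ := by
    intro u g hg
    obtain ⟨h, hh, hn⟩ := hC' u g hg
    exact ⟨h, hh, hn.trans (by gcongr; exact le_max_left _ _)⟩
  set R : ℝ := √n + 2 with hR
  have hR0 : 0 < R := by positivity
  refine ⟨(R ^ n * (98 * C / c) ^ 2).toNNReal, fun {ι} Q hQ f hf hne => ?_⟩
  choose U z s hs hUo hUQ hUae hBU hUB using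
    fun i => exists_isOpen_ae_eq_of_isCube_or_isBall (hQ i)
  have hpos : ∀ i, volume (U i) ≠ 0 := fun i =>
    ((Metric.measure_ball_pos volume (z i) (hs i)).trans_le (measure_mono (hBU i))).ne'
  have hfin : ∀ i, volume (U i) ≠ ∞ := fun i =>
    ((measure_mono (hUB i)).trans_lt measure_ball_lt_top).ne
  have hrestr : ∀ i, volume.restrict (Q i) = volume.restrict (U i) := fun i =>
    (Measure.restrict_congr_set (hUae i)).symm
  obtain ⟨g, hg⟩ : ∃ g : X, ∀ᵐ x, ‖J g x‖ₑ = ‖f x‖ₑ * overlap Q x ^ (1 / 2 : ℝ) := by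
    by_contra hcon
    refine hne ?_
    simp only [latticeENorm, iInf_eq_top]
    intro g hg
    exact absurd ⟨g, hg⟩ hcon
  set φ : EuclideanSpace ℝ (Fin n) → ℝ≥0∞ := fun x => ‖hf.mk f x‖ₑ with hφdef
  have hφ : Measurable φ := hf.stronglyMeasurable_mk.measurable.enorm
  have hφf : ∀ᵐ x, φ x = ‖f x‖ₑ := by
    filter_upwards [hf.ae_eq_mk] with x hx
    simp only [hφdef, hx]
  -- Outside this countable set of indices `f` vanishes a.e. on the set, so its average there is 0
  -- and the term drops from the square function.
  set I : Set ι := {i | volume (U i ∩ {x | φ x ≠ 0}) ≠ 0} with hI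
  have hIc : I.Countable := countable_setOf_measure_inter_support_ne_zero hUo hUQ hφ
    (fun x => enorm_ne_top) (J g) (by
      filter_upwards [hg, hφf] with x h1 h2
      rw [h1, h2])
  have : Countable I := hIc.to_subtype
  have hzero : ∀ i ∉ I, f =ᵐ[volume.restrict (Q i)] 0 := by
    intro i hi
    rw [hrestr i, Filter.EventuallyEq, ae_restrict_iff' (hUo i).measurableSet]
    have h0 : ∀ᵐ x, x ∉ U i ∩ {x | φ x ≠ 0} := measure_eq_zero_iff_ae_notMem.1 (not_not.1 hi)
    filter_upwards [h0, hφf] with x h1 h2 hxU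
    by_contra hfx
    refine h1 ⟨hxU, ?_⟩
    rw [Set.mem_ofPred_eq, h2]
    simpa using hfx
  have hK : ∀ (t : Finset I) (w : EuclideanSpace ℝ (Fin n) → ℝ) (M : ℝ), (∀ x, 0 ≤ w x) →
      Measurable w → (∀ x, w x ≤ M) →
      upperENorm J (fun x =>
        ENNReal.ofReal √(∑ i ∈ t, (U i).indicator (fun _ => (⨍ y in U i, w y) ^ 2) x)) ≤
      ENNReal.ofReal (R ^ n * (98 * C / c) ^ 2) * upperENorm J (fun x =>
        ENNReal.ofReal (w x * √(∑ i ∈ t, (U i).indicator (fun _ => 1) x))) := by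
    intro t w M hw hwm hwM
    have h := upperENorm_sqrt_sum_average_le (ι := t) hX hC hc hTC hT
      (z := fun i => z i) (s := fun i => s i) (fun i => hs i) hR0 (Q := fun i => U i)
      (fun i => (hUo i).measurableSet) (fun i => hBU i) (fun i => hUB i) hw hwm hwM
    have e1 := fun x => Finset.sum_coe_sort t
      fun i => (U i).indicator (fun _ => (⨍ y in U i, w y) ^ 2) x
    have e2 := fun x => Finset.sum_coe_sort t fun i => (U i).indicator (fun _ => (1 : ℝ)) x
    simp only [e1, e2] at h
    exact h
  have hmain := upperENorm_squareLAverage_le (ι := I) hX hFatou (U := fun i => U i)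
    (fun i => hUo i) (fun i => hpos i) (fun i => hfin i) hK hφ
  have hright : upperENorm J (fun x => φ x * overlap (fun i : I => U i) x ^ (1 / 2 : ℝ)) ≤
      latticeENorm J (fun x => ‖f x‖ₑ * overlap Q x ^ (1 / 2 : ℝ)) := by
    refine le_trans (upperENorm_mono_ae ?_) (upperENorm_le_latticeENorm _)
    filter_upwards [hφf] with x hx
    rw [hx]
    gcongr
    unfold overlap
    refine (ENNReal.tsum_comp_le_tsum_of_injective Subtype.val_injective
      fun i => (U i).indicator (fun _ => (1 : ℝ≥0∞)) x).trans
      (ENNReal.tsum_le_tsum fun i => ?_)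
    exact Set.indicator_le_indicator_of_subset (hUQ i) (fun _ => zero_le) x
  have hbound := hmain.trans (mul_le_mul_right hright _)
  set Φ : EuclideanSpace ℝ (Fin n) → ℝ≥0∞ := fun x =>
    (∑' i : I, (U i).indicator (fun _ => (⨍⁻ y in U i, φ y ∂volume) ^ 2) x) ^ (1 / 2 : ℝ) with hΦ
  have hΦm : Measurable Φ := (Measurable.tsum fun i : I =>
    measurable_const.indicator (hUo i).measurableSet).pow_const _
  have hΦtop : ∀ᵐ x, Φ x ≠ ∞ := (exists_of_upperENorm_ne_top hX hΦm.aemeasurable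
    (ne_top_of_le_ne_top (ENNReal.mul_ne_top ENNReal.ofReal_ne_top hne) hbound)).1
  have hint : ∀ i, IntegrableOn f (Q i) volume := by
    intro i
    -- For `i ∈ I`, an infinite average would make `Φ` infinite on all of `U i`, which has positive
    -- measure; for other `i`, `f` is zero a.e. on `Q i`.
    by_cases hi : i ∈ I
    · have hLtop : ⨍⁻ y in U i, φ y ∂volume ≠ ∞ := by
        intro htop
        refine hpos i (measure_mono_null ?_ (ae_iff.1 hΦtop))
        intro x hx
        simp only [Set.mem_ofPred_eq, not_not, hΦ]
        rw [ENNReal.rpow_eq_top_iff_of_pos (by norm_num), eq_top_iff]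
        refine le_trans ?_ (ENNReal.le_tsum ⟨i, hi⟩)
        simp [hx, htop]
      refine ⟨hf.restrict, ?_⟩
      rw [setLAverage_eq] at hLtop
      have hl : ∫⁻ y in U i, φ y ≠ ∞ := fun h =>
        hLtop (by rw [h, ENNReal.top_div_of_ne_top (hfin i)])
      rw [HasFiniteIntegral, hrestr i, ← lintegral_congr_ae (ae_restrict_of_ae hφf)]
      exact hl.lt_top
    · exact (integrable_zero _ _ _).congr (hzero i hi).symm
  refine ⟨hint, ?_⟩
  have hsq : ∀ x, squareAveraging Q f x =
      (∑' i : I, (Q i).indicator (fun _ => ‖⨍ y in Q i, f y‖ₑ ^ 2) x) ^ (1 / 2 : ℝ) := by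
    intro x
    unfold squareAveraging
    congr 1
    refine (tsum_subtype_eq_of_support_subset fun i hi => ?_).symm
    by_contra hiI
    refine hi ?_
    have : ⨍ y in Q i, f y = 0 := by
      rw [average_congr (hzero i hiI)]
      simp [average_eq]
    simp [this]
  have hmeas : AEMeasurable (squareAveraging Q f) volume := by
    rw [funext hsq]
    refine (AEMeasurable.tsum fun i : I => ?_).pow_const _
    exact aemeasurable_const.indicator₀ ((hUo i).measurableSet.nullMeasurableSet.congr (hUae i))
  refine (latticeENorm_le_upperENorm hX hmeas).trans (le_trans (upperENorm_mono_ae ?_) hbound)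
  -- The exceptional null sets can be united only because `I` is countable.
  have hall : ∀ᵐ x, ∀ i : I, x ∈ U i ↔ x ∈ Q i :=
    ae_all_iff.2 fun i => (hUae i).mem_iff
  filter_upwards [hall] with x hx
  rw [hsq]
  refine ENNReal.rpow_le_rpow (ENNReal.tsum_le_tsum fun i => ?_) (by norm_num)
  by_cases hxi : x ∈ U i
  · rw [Set.indicator_of_mem hxi, Set.indicator_of_mem ((hx i).1 hxi), hrestr i]
    gcongr
    refine (enorm_integral_le_lintegral_enorm _).trans_eq ?_
    refine (lintegral_congr_ae ?_).symm
    exact Measure.ae_smul_measure (ae_restrict_of_ae hφf) _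
  · rw [Set.indicator_of_notMem hxi, Set.indicator_of_notMem fun h => hxi ((hx i).2 h)]
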